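/- Let $\mathbb K$ be $\mathbb R$ or $\mathbb C$, let $G=\mathrm{GL}_6(\mathbb K)$, and write $x^\tau$ for the transpose of a matrix $x$. Let $S\subset G$ be the subgroup of all matrices $\begin{bmatrix}a&b&d\\0&a&c\\0&0&a\end{bmatrix}$ with $a\in\mathrm{GL}_2(\mathbb K)$ and $b,c,d\in\mathfrak{gl}_2(\mathbb K)$. Fix a continuous homomorphism $\chi_{\mathbb K^\times}:\mathbb K^\times\to\mathbb C^\times$ and a nontrivial unitary character $\psi_{\mathbb K}$ of the additive group $\mathbb K$, and let $\chi_S$ be the character of $S$ given by $$\chi_S\left(\begin{bmatrix}1&b&d\\0&1&c\\0&0&1\end{bmatrix}\begin{bmatrix}a&0&0\\0&a&0\\0&0&a\end{bmatrix}\right)=\chi_{\mathbb K^\times}(\det a)\,\psi_{\mathbb K}(\mathrm{tr}(b+c)).$$ A generalized function on $G$ is a continuous linear functional on the space of compactly supported smooth densities on $G$. Let $\Delta$ be the Casimir element of the real Lie algebra $\mathfrak{gl}_6(\mathbb K)$ with respect to the real trace form $\langle x,y\rangle=\mathrm{Re}\,\mathrm{tr}(xy)$, viewed as a bi-invariant differential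 operator on $G$. Let $G'$ be the open set of all $x\in G$ such that the lower right $2\times4$ and $4\times2$ blocks of $x$ have rank $2$, its lower right $2\times2$ block has rank at least $1$, and its lower right $4\times4$ block has rank at least $3$. (This is a union of four of the $21$ double cosets of $P$ and $P^\tau$ in $G$, where $P$ is the group of invertible block upper triangular matrices with $2\times 2$ blocks.) Let $f$ be a generalized function on $G$ such that $$f(g_1xg_2^\tau)=\chi_S(g_1)\chi_S(g_2)f(x)\quad\text{for all } g_1,g_2\in S,$$ and such that $\Delta f=\mu f$ for some $\mu\in\mathbb C$. If $f$ vanishes on $G'$, then $f=0$. -/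

import Mathlib

open scoped Distributions ContDiff

noncomputable section

namespace GinzburgRallis

/-- The algebra `𝔤𝔩₆(K)` of `6 × 6` matrices. -/
abbrev Mat (K : Type*) : Type _ := Matrix (Fin 6) (Fin 6) K

/- Any norm will do here: it only serves to speak of smooth functions on the finite-dimensional
real vector space of `6 × 6` matrices. -/

instance matNormedAddCommGroup (K : Type*) [RCLike K] : NormedAddCommGroup (Mat K) :=
  Matrix.normedAddCommGroup

instance matNormedSpace (K : Type*) [RCLike K] : NormedSpace ℝ (Mat K) :=
  Matrix.normedSpace

instance matTopologicalSpace (K : Type*) [RCLike K] : TopologicalSpace (Mat K) :=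
  PseudoMetricSpace.toUniformSpace.toTopologicalSpace

/-- The algebra `𝔤𝔩₂(K)` of `2 × 2` matrices. -/
abbrev Mat2 (K : Type*) : Type _ := Matrix (Fin 2) (Fin 2) K

/-- A `3 × 3` matrix of `2 × 2` blocks, read as a `6 × 6` matrix. -/
def ofBlocks (K : Type*) [RCLike K] : Matrix (Fin 3) (Fin 3) (Mat2 K) ≃ₐ[K] Mat K :=
  (Matrix.compAlgEquiv (Fin 3) (Fin 2) K K).trans
    (Matrix.reindexAlgEquiv K K (finProdFinEquiv.trans (finCongr (by norm_num))))

/-! ### The subgroup `S` and its character -/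

lemma blocks_mul {K : Type*} [RCLike K] (a b c d a' b' c' d' : Mat2 K) :
    (!![a, b, d; 0, a, c; 0, 0, a] : Matrix (Fin 3) (Fin 3) (Mat2 K)) *
        !![a', b', d'; 0, a', c'; 0, 0, a'] =
      !![a * a', a * b' + b * a', a * d' + b * c' + d * a'; 0, a * a', a * c' + c * a';
        0, 0, a * a'] := by
  rw [Matrix.mul_fin_three]
  simp

lemma blocks_one {K : Type*} [RCLike K] :
    (!![1, 0, 0; 0, 1, 0; 0, 0, 1] : Matrix (Fin 3) (Fin 3) (Mat2 K)) = 1 :=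
  Matrix.one_fin_three.symm

/-- The subgroup `S` of `GL₆(K)` of all block matrices `[a, b, d; 0, a, c; 0, 0, a]`. -/
def S (K : Type*) [RCLike K] : Subgroup (GL (Fin 6) K) where
  carrier := {g | ∃ a b c d : Mat2 K, (g : Mat K) = ofBlocks K !![a, b, d; 0, a, c; 0, 0, a]}
  one_mem' := ⟨1, 0, 0, 0, by rw [blocks_one, map_one]; rfl⟩
  mul_mem' := by
    rintro g g' ⟨a, b, c, d, h⟩ ⟨a', b', c', d', h'⟩
    exact ⟨_, _, _, _, by rw [Units.val_mul, h, h', ← map_mul, blocks_mul]⟩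
  inv_mem' := by
    rintro g ⟨a, b, c, d, h⟩
    obtain ⟨B, hB⟩ := (ofBlocks K).surjective ((g⁻¹ : GL (Fin 6) K) : Mat K)
    have h1 : (!![a, b, d; 0, a, c; 0, 0, a] : Matrix (Fin 3) (Fin 3) (Mat2 K)) * B = 1 := by
      apply (ofBlocks K).injective
      rw [map_mul, hB, ← h, map_one, ← Units.val_mul, mul_inv_cancel, Units.val_one]
    have h2 : a * B 2 2 = 1 := by
      have := congrFun (congrFun h1 2) 2
      simpa [Matrix.mul_apply, Fin.sum_univ_three] using this
    have h3 : B 2 2 * a = 1 := mul_eq_one_comm.mp h2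
    set e := B 2 2
    refine ⟨e, -(e * b * e), -(e * c * e), e * b * e * c * e - e * d * e, ?_⟩
    have h4 : (!![e, -(e * b * e), e * b * e * c * e - e * d * e; 0, e, -(e * c * e); 0, 0, e] :
        Matrix (Fin 3) (Fin 3) (Mat2 K)) * !![a, b, d; 0, a, c; 0, 0, a] = 1 := by
      rw [blocks_mul, ← blocks_one, h3]
      simp only [neg_mul, sub_mul, mul_assoc, h3, mul_one]
      congr <;> abel_nf
    rw [← hB, left_inv_eq_right_inv h4 h1]

variable {K : Type*} [RCLike K]

/-- The `(i, j)` block, of size `2 × 2`, of a `6 × 6` matrix. -/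
def block (i j : Fin 3) (x : Mat K) : Mat2 K := (ofBlocks K).symm x i j

lemma block_zero_zero_mul (s t : S K) :
    block 0 0 ((s * t : S K) : GL (Fin 6) K).val = block 0 0 s.1.val * block 0 0 t.1.val := by
  obtain ⟨⟨g, hg⟩, ⟨g', hg'⟩⟩ := s, t
  obtain ⟨⟨a, b, c, d, h⟩, ⟨a', b', c', d', h'⟩⟩ := hg, hg'
  simp [block, h, h']

lemma block_zero_zero_one : block 0 0 ((1 : S K) : GL (Fin 6) K).val = 1 := by
  simp [block]

/-- The homomorphism from `S` to `GL₂(K)` sending `[a, b, d; 0, a, c; 0, 0, a]` to `a`. -/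
def diagPart : S K →* GL (Fin 2) K :=
  MonoidHom.toHomUnits
    { toFun := fun s => block 0 0 s.1.val
      map_one' := block_zero_zero_one
      map_mul' := block_zero_zero_mul }

/-- For `s = [1, b, d; 0, 1, c; 0, 0, 1] · diag (a, a, a)`, this is `tr (b + c)`. -/
def unipTrace (s : S K) : K :=
  ((block 0 1 s.1.val + block 1 2 s.1.val) * ((diagPart s)⁻¹ : GL (Fin 2) K).val).trace

lemma unipTrace_one : unipTrace (1 : S K) = 0 := by
  simp [unipTrace, block]

lemma unipTrace_mul (s t : S K) : unipTrace (s * t) = unipTrace s + unipTrace t := by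
  have hs : (diagPart s).val = block 0 0 s.1.val := rfl
  have ht : (diagPart t).val = block 0 0 t.1.val := rfl
  have key : block 0 1 ((s * t : S K) : GL (Fin 6) K).val + block 1 2 ((s * t : S K) : GL _ K).val =
      (diagPart s).val * (block 0 1 t.1.val + block 1 2 t.1.val) +
        (block 0 1 s.1.val + block 1 2 s.1.val) * (diagPart t).val := by
    rw [hs, ht]
    obtain ⟨⟨g, hg⟩, ⟨g', hg'⟩⟩ := s, t
    obtain ⟨⟨a, b, c, d, h⟩, ⟨a', b', c', d', h'⟩⟩ := hg, hg'
    simp only [block, Subgroup.coe_mul, Units.val_mul, h, h', map_mul, AlgEquiv.symm_apply_apply,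
      blocks_mul]
    simp [mul_add, add_mul]
    abel
  rw [unipTrace, key, map_mul, mul_inv_rev, Units.val_mul, add_mul, Matrix.trace_add]
  have e1 : ((diagPart s).val * (block 0 1 t.1.val + block 1 2 t.1.val) *
      (((diagPart t)⁻¹ : GL (Fin 2) K).val * ((diagPart s)⁻¹ : GL (Fin 2) K).val)).trace =
      unipTrace t := by
    rw [← mul_assoc, Matrix.trace_mul_comm, mul_assoc, ← mul_assoc, Units.inv_mul, one_mul]
    rfl
  have e2 : (block 0 1 s.1.val + block 1 2 s.1.val) * (diagPart t).val *
      (((diagPart t)⁻¹ : GL (Fin 2) K).val * ((diagPart s)⁻¹ : GL (Fin 2) K).val) =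
      (block 0 1 s.1.val + block 1 2 s.1.val) * ((diagPart s)⁻¹ : GL (Fin 2) K).val := by
    rw [mul_assoc, ← mul_assoc (diagPart t).val, Units.mul_inv, one_mul]
  rw [e1, e2, add_comm]
  rfl

/-- The character `χ_S` of `S` attached to a character `χ` of `Kˣ` and an additive unitary
character `ψ` of `K`, see `chiS_apply`. -/
def chiS (χ : Kˣ →* ℂˣ) (ψ : AddChar K Circle) : S K →* ℂˣ where
  toFun s := χ (Matrix.GeneralLinearGroup.det (diagPart s)) * Circle.toUnits (ψ (unipTrace s))
  map_one' := by simp [unipTrace_one]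
  map_mul' s t := by
    rw [map_mul, map_mul, map_mul, unipTrace_mul, AddChar.map_add_eq_mul, map_mul]
    exact mul_mul_mul_comm _ _ _ _

lemma chiS_apply (χ : Kˣ →* ℂˣ) (ψ : AddChar K Circle) (s : S K) (a : GL (Fin 2) K)
    (b c d : Mat2 K)
    (h : s.1.val = ofBlocks K (!![1, b, d; 0, 1, c; 0, 0, 1] *
      !![a.val, 0, 0; 0, a.val, 0; 0, 0, a.val])) :
    (chiS χ ψ s : ℂ) =
      (χ (Matrix.GeneralLinearGroup.det a) : ℂ) * (ψ (b + c).trace : ℂ) := by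
  have ha : diagPart s = a := by
    ext1
    change block 0 0 s.1.val = a.val
    simp [block, h]
  have ht : unipTrace s = (b + c).trace := by
    have : block 0 1 s.1.val + block 1 2 s.1.val = (b + c) * a.val := by
      rw [blocks_mul] at h
      simp [block, h, add_mul]
    rw [unipTrace, this, ha, mul_assoc, Units.mul_inv, mul_one]
  simp [chiS, ha, ht]

/-! ### Generalized functions on `GL₆(K)`

The group `GL₆(K)` is an open submanifold of the real vector space `𝔤𝔩₆(K)`. It is unimodular, so
`φ ↦ φ(x) dx`, for a bi-invariant Haar measure `dx` on `GL₆(K)`, identifies smooth functions with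
compact support with smooth densities with compact support. A generalized function, that is a
continuous linear form on the space of these densities, is thus an element `f` of
`𝓓'(GLOpen K, ℂ)`, the value `f φ` being that of the generalized function at the density
`φ(x) dx`. An ordinary function `u` is the generalized function `φ ↦ ∫ u(x) φ(x) dx`.

Since `dx` is bi-invariant, pulling back a generalized function along the diffeomorphism
`x ↦ g₁ x g₂ᵀ` is dual to composing test functions with the inverse diffeomorphism, and the
invariant vector field `X` acts on generalized functions as minus the transpose of its action on
test functions, with no Jacobian or divergence term. -/

/-- `GL₆(K)` as an open subset of the space of matrices. -/
def GLOpen (K : Type*) [RCLike K] : TopologicalSpace.Opens (Mat K) :=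
  ⟨{x | x.det ≠ 0}, isOpen_ne_fun (Continuous.matrix_det continuous_id) continuous_const⟩

/-- The action `(g₁, g₂) x = g₁ x g₂ᵀ`. -/
def act (g₁ g₂ : GL (Fin 6) K) (x : Mat K) : Mat K := g₁.val * x * g₂.val.transpose

/-- The action of `(g₁, g₂)` as a linear automorphism of the space of matrices. -/
def actEquiv (g₁ g₂ : GL (Fin 6) K) : Mat K ≃L[ℝ] Mat K :=
  LinearEquiv.toContinuousLinearEquiv
    { toFun := act g₁ g₂
      invFun := act g₁⁻¹ g₂⁻¹
      map_add' := fun x y => by simp [act, mul_add, add_mul]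
      map_smul' := fun r x => by simp [act]
      left_inv := fun x => by
        have h : g₂.val.transpose * (g₂⁻¹ : GL (Fin 6) K).val.transpose = 1 := by
          rw [← Matrix.transpose_mul, Units.inv_mul, Matrix.transpose_one]
        simp only [act, mul_assoc, h, mul_one, Units.inv_mul_cancel_left]
      right_inv := fun x => by
        have h : (g₂⁻¹ : GL (Fin 6) K).val.transpose * g₂.val.transpose = 1 := by
          rw [← Matrix.transpose_mul, Units.mul_inv, Matrix.transpose_one]
        simp only [act, mul_assoc, h, mul_one, Units.mul_inv_cancel_left] }

lemma det_act_ne_zero_iff (g₁ g₂ : GL (Fin 6) K) (x : Mat K) :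
    (act g₁ g₂ x).det ≠ 0 ↔ x.det ≠ 0 := by
  have h1 : g₁.val.det ≠ 0 := g₁.det_ne_zero
  have h2 : g₂.val.det ≠ 0 := g₂.det_ne_zero
  simp [act, h1, h2]

/-- The push-forward of a test density `φ(x) dx` under `x ↦ g₁ x g₂ᵀ`: the density
`φ(g₁⁻¹ x g₂⁻ᵀ) dx`. -/
def pushTest (g₁ g₂ : GL (Fin 6) K) : 𝓓(GLOpen K, ℝ) →ₗ[ℝ] 𝓓(GLOpen K, ℝ) where
  toFun φ :=
    { toFun := fun x => φ (act g₁⁻¹ g₂⁻¹ x)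
      contDiff' := φ.contDiff.comp (actEquiv g₁⁻¹ g₂⁻¹).contDiff
      hasCompactSupport' :=
        φ.hasCompactSupport.comp_homeomorph (actEquiv g₁⁻¹ g₂⁻¹).toHomeomorph
      tsupport_subset' := fun x hx => by
        have h1 : act g₁⁻¹ g₂⁻¹ x ∈ tsupport φ :=
          tsupport_comp_subset_preimage φ (actEquiv g₁⁻¹ g₂⁻¹).continuous hx
        exact (det_act_ne_zero_iff _ _ _).mp (φ.tsupport_subset h1) }
  map_add' _ _ := rfl
  map_smul' _ _ := rfl

/-- The pull-back `x ↦ f(g₁ x g₂ᵀ)` of a generalized function (as a linear form). -/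
def pullback (g₁ g₂ : GL (Fin 6) K) (f : 𝓓(GLOpen K, ℝ) →ₗ[ℝ] ℂ) : 𝓓(GLOpen K, ℝ) →ₗ[ℝ] ℂ :=
  f ∘ₗ pushTest g₁ g₂

/-- The space of generalized functions `f` on `GL₆(K)` with
`f(s₁ x s₂ᵀ) = χ_S(s₁) χ_S(s₂) f(x)` for all `s₁, s₂ ∈ S`. -/
def IsEquivariant (χ : Kˣ →* ℂˣ) (ψ : AddChar K Circle) (f : 𝓓'(GLOpen K, ℂ)) : Prop :=
  ∀ s₁ s₂ : S K, pullback s₁.1 s₂.1 (f : 𝓓(GLOpen K, ℝ) →ₗ[ℝ] ℂ) =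
    ((chiS χ ψ s₁ : ℂ) * (chiS χ ψ s₂ : ℂ)) • (f : 𝓓(GLOpen K, ℝ) →ₗ[ℝ] ℂ)

/-! ### The Casimir operator -/

/-- The real trace form `⟨x, y⟩ = Re tr (x y)` on `𝔤𝔩₆(K)`. -/
def traceForm (K : Type*) [RCLike K] : LinearMap.BilinForm ℝ (Mat K) :=
  LinearMap.mk₂ ℝ (fun x y => RCLike.re (x * y).trace)
    (fun x x' y => by simp [add_mul])
    (fun r x y => by simp [RCLike.smul_re])
    (fun x y y' => by simp [mul_add])
    (fun r x y => by simp [RCLike.smul_re])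

lemma traceForm_nondegenerate (K : Type*) [RCLike K] : (traceForm K).Nondegenerate := by
  have h : ∀ x : Mat K, RCLike.re (x * x.conjTranspose).trace = 0 → x = 0 := by
    intro x hx
    have h1 : RCLike.re (x * x.conjTranspose).trace = ∑ i, ∑ j, ‖x i j‖ ^ 2 := by
      simp only [Matrix.trace, Matrix.diag, Matrix.mul_apply, Matrix.conjTranspose_apply, map_sum]
      refine Finset.sum_congr rfl fun i _ => Finset.sum_congr rfl fun j _ => ?_
      rw [RCLike.star_def, RCLike.mul_conj, ← RCLike.ofReal_pow, RCLike.ofReal_re]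
    rw [h1, Finset.sum_eq_zero_iff_of_nonneg (fun i _ => Finset.sum_nonneg fun j _ => by
      positivity)] at hx
    ext i j
    have h2 := hx i (Finset.mem_univ _)
    rw [Finset.sum_eq_zero_iff_of_nonneg (fun j _ => by positivity)] at h2
    simpa using h2 j (Finset.mem_univ _)
  constructor
  · intro x hx
    exact h x (hx x.conjTranspose)
  · intro x hx
    refine h x ?_
    rw [Matrix.trace_mul_comm]
    exact hx x.conjTranspose

/-- The left invariant vector field `x ↦ x A` acting on test functions:
`(X_A φ)(x) = d/dt φ(x exp (t A))` at `t = 0`. -/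
def leftField (A : Mat K) : 𝓓(GLOpen K, ℝ) →ₗ[ℝ] 𝓓(GLOpen K, ℝ) where
  toFun φ :=
    { toFun := fun x => fderiv ℝ φ x (x * A)
      contDiff' := by
        have h : ContDiff ℝ ∞ (fun x : Mat K => x * A) :=
          (LinearMap.toContinuousLinearMap (LinearMap.mulRight ℝ A)).contDiff
        exact (φ.contDiff.fderiv_right (m := ∞) (by simp)).clm_apply h
      hasCompactSupport' := by
        refine (φ.hasCompactSupport.fderiv ℝ).mono fun x hx => ?_
        contrapose! hx
        simp only [Function.mem_support, not_not] at hx ⊢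
        simp [hx]
      tsupport_subset' := by
        refine Set.Subset.trans ?_ ((tsupport_fderiv_subset ℝ).trans φ.tsupport_subset)
        refine closure_mono fun x hx => ?_
        contrapose! hx
        simp only [Function.mem_support, not_not] at hx ⊢
        simp [hx] }
  map_add' φ φ' := by
    ext x
    have h1 : DifferentiableAt ℝ φ x := φ.contDiff.differentiable (by simp) x
    have h2 : DifferentiableAt ℝ φ' x := φ'.contDiff.differentiable (by simp) x
    change fderiv ℝ (⇑φ + ⇑φ') x (x * A) = fderiv ℝ φ x (x * A) + fderiv ℝ φ' x (x * A)
    rw [fderiv_add h1 h2]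
    rfl
  map_smul' r φ := by
    ext x
    have h1 : DifferentiableAt ℝ φ x := φ.contDiff.differentiable (by simp) x
    change fderiv ℝ (r • ⇑φ) x (x * A) = r • fderiv ℝ φ x (x * A)
    rw [fderiv_const_smul h1]
    rfl

/-- The left invariant vector field `x ↦ x A` acting on generalized functions. -/
def leftDeriv (A : Mat K) (f : 𝓓(GLOpen K, ℝ) →ₗ[ℝ] ℂ) : 𝓓(GLOpen K, ℝ) →ₗ[ℝ] ℂ :=
  -(f ∘ₗ leftField A)

/-- The Casimir operator `Δ f = ∑ i, X_i X_i' f` of the real trace form, where the `X_i` form a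
basis of the real Lie algebra `𝔤𝔩₆(K)` and the `X_i'` form the dual basis. The operator does not
depend on the basis. -/
def casimir (f : 𝓓(GLOpen K, ℝ) →ₗ[ℝ] ℂ) : 𝓓(GLOpen K, ℝ) →ₗ[ℝ] ℂ :=
  ∑ i, leftDeriv (Module.finBasis ℝ (Mat K) i)
    (leftDeriv ((traceForm K).dualBasis (traceForm_nondegenerate K)
      (Module.finBasis ℝ (Mat K)) i) f)

/-! ### The open set `G'` -/

/-- The rank of the lower right `i × j` block of `x`. -/
def lrRank (i j : ℕ) (x : Mat K) : ℕ :=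
  (x.toBlock (fun r => 6 ≤ r.val + i) (fun c => 6 ≤ c.val + j)).rank

/-- The open set `G'`. It is the union of the four double cosets of `P` and `Pᵀ`, where `P` is the
group of invertible block upper triangular matrices with `2 × 2` blocks, given by the rank matrices
`[r₄ₓ₄, r₄ₓ₂; r₂ₓ₄, r₂ₓ₂]` equal to
`[4, 2; 2, 2]`, `[4, 2; 2, 1]`, `[3, 2; 2, 2]`, `[3, 2; 2, 1]`. -/
def GPrime (K : Type*) [RCLike K] : Set (Mat K) :=
  {x | x.det ≠ 0 ∧ lrRank 2 4 x = 2 ∧ lrRank 4 2 x = 2 ∧ 1 ≤ lrRank 2 2 x ∧ 3 ≤ lrRank 4 4 x}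

end GinzburgRallis

end

/-! Suppose `f ≠ 0`. The proof finds a point of the support of `f` that lies in the open set `GPrime
K`, which is absurd. Write `J` for `shift K`, and let `π`, `ρ` be the projections onto the last
block rows and columns that cut out a lower right corner `π x ρ`. Among the invertible points of the
support, choose `x₀` maximizing the sum of the ranks of the four corners with `k, l ∈ {1, 2}`. Rank
is lower semicontinuous, so on the support near `x₀` each of these ranks is constant.

First constraint (`trace_kernelMatrix_eq_zero`). Let `Θ = ρ Θ π` satisfy `π x Θ = 0` and `Θ x ρ =
0`. Then `x Θ` lies in the Lie algebra of a unipotent radical acting from the left, `Θ x` in that of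
an opposite one acting from the right, and the vector field `x Θ x` is `(x Θ) x` as well as `x (Θ
x)`. Equivariance evaluates it in two ways, and comparison of the two characters gives `tr (Θ (J x -
x Jᵀ)) = 0`. Since `Θ` must vary with `x`, it is extended to a smooth family that stays in the
kernel wherever the corner rank does not exceed that at `x₀`. The error terms vanish on the support,
hence are nilpotent on `f` because `f` has locally finite order. A suitable multiple `Q f ≠ 0` is
killed by all of them, and it is still equivariant because `Q` depends only on the corner.

Second constraint (`trace_sq_kernelMatrix_eq_zero`). By the first one, the functions `Re (c tr (Θ(x)
(J x - x Jᵀ)))` vanish on the support near `x₀`. If the Casimir symbol were nonzero on such a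
differential, the eigenvalue equation would force `f = 0` near `x₀`
(`isVanishingOn_of_noncharacteristic`). Hence `tr ((Θ J x)²) + tr ((Θ x Jᵀ)²) = 0`.

For `Θ = u wᵀ` the first constraint equates `wᵀ J x u` and `wᵀ x Jᵀ u`, and the second says that
their squares sum to zero. So both vanish, which is `IsConstrained x₀`. Elementary linear algebra
(`IsConstrained.mem_GPrime`) then places `x₀` in `GPrime K`. -/

noncomputable section

namespace GinzburgRallis

open Set TopologicalSpace Function Filter Topology Distribution

/-! ### Smooth multipliers and vector fields on test functions. -/

section Calculus

variable {E : Type*} [NormedAddCommGroup E] [NormedSpace ℝ E] {Ω : Opens E}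

/-- The algebra of smooth real functions on a normed space. -/
def smoothFunctions (E : Type*) [NormedAddCommGroup E] [NormedSpace ℝ E] :
    Subalgebra ℝ (E → ℝ) where
  carrier := {q | ContDiff ℝ ∞ q}
  mul_mem' {p q} (hp : ContDiff ℝ ∞ p) (hq : ContDiff ℝ ∞ q) := hp.mul hq
  add_mem' {p q} (hp : ContDiff ℝ ∞ p) (hq : ContDiff ℝ ∞ q) := hp.add hq
  algebraMap_mem' r := show ContDiff ℝ ∞ fun _ => r from contDiff_const

lemma contDiff_smooth (q : smoothFunctions E) : ContDiff ℝ ∞ q.1 := q.2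

lemma differentiableAt_smooth (q : smoothFunctions E) (x : E) :
    DifferentiableAt ℝ q.1 x := (contDiff_smooth q).differentiable (by simp) x

lemma differentiableAt_test (φ : 𝓓(Ω, ℝ)) (x : E) : DifferentiableAt ℝ φ x :=
  φ.contDiff.differentiable (by simp) x

/-- Multiplication of test functions by smooth functions. -/
def mulSmooth : smoothFunctions E →ₐ[ℝ] Module.End ℝ 𝓓(Ω, ℝ) where
  toFun q :=
    { toFun φ := ⟨fun x => q.1 x * φ x, (contDiff_smooth q).mul φ.contDiff, φ.hasCompactSupport.mul_left,
        (tsupport_mul_subset_right).trans φ.tsupport_subset⟩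
      map_add' φ φ' := by ext x; simp [mul_add]
      map_smul' r φ := by ext x; simp [mul_left_comm] }
  map_one' := by ext φ x; simp
  map_mul' q q' := by ext φ x; simp [mul_assoc]
  map_zero' := by ext φ x; simp
  map_add' q q' := by ext φ x; simp [add_mul]
  commutes' r := by ext φ x; simp

@[simp]
lemma mulSmooth_apply (q : smoothFunctions E) (φ : 𝓓(Ω, ℝ)) (x : E) :
    mulSmooth q φ x = q.1 x * φ x := rfl

lemma tsupport_mulSmooth_subset (q : smoothFunctions E) (φ : 𝓓(Ω, ℝ)) :
    tsupport (mulSmooth q φ) ⊆ tsupport φ :=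
  tsupport_mul_subset_right (f := q.1)

/-- The action of a smooth vector field on test functions. -/
def vectorField (v : E → E) (hv : ContDiff ℝ ∞ v) : Module.End ℝ 𝓓(Ω, ℝ) where
  toFun φ :=
    { toFun := fun x => fderiv ℝ φ x (v x)
      contDiff' := (φ.contDiff.fderiv_right (m := ∞) (by simp)).clm_apply hv
      hasCompactSupport' := by
        refine (φ.hasCompactSupport.fderiv ℝ).mono fun x hx => ?_
        contrapose! hx
        simp only [Function.mem_support, not_not] at hx ⊢
        simp [hx]
      tsupport_subset' := by
        refine Set.Subset.trans ?_ ((tsupport_fderiv_subset ℝ).trans φ.tsupport_subset)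
        refine closure_mono fun x hx => ?_
        contrapose! hx
        simp only [Function.mem_support, not_not] at hx ⊢
        simp [hx] }
  map_add' φ φ' := by
    ext x
    change fderiv ℝ (⇑φ + ⇑φ') x (v x) = fderiv ℝ φ x (v x) + fderiv ℝ φ' x (v x)
    rw [fderiv_add (differentiableAt_test φ x) (differentiableAt_test φ' x)]
    rfl
  map_smul' r φ := by
    ext x
    change fderiv ℝ (r • ⇑φ) x (v x) = r • fderiv ℝ φ x (v x)
    rw [fderiv_const_smul (differentiableAt_test φ x)]
    rfl

@[simp]
lemma vectorField_apply (v : E → E) (hv : ContDiff ℝ ∞ v) (φ : 𝓓(Ω, ℝ)) (x : E) :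
    vectorField v hv φ x = fderiv ℝ φ x (v x) := rfl

lemma tsupport_vectorField_subset (v : E → E) (hv : ContDiff ℝ ∞ v) (φ : 𝓓(Ω, ℝ)) :
    tsupport (vectorField v hv φ) ⊆ tsupport φ := by
  refine Set.Subset.trans (closure_mono fun x hx => ?_) (tsupport_fderiv_subset ℝ)
  contrapose! hx
  simp only [Function.mem_support, not_not] at hx ⊢
  simp [hx]

/-- The derivative of a smooth function along a smooth vector field. -/
def derivAlong (v : E → E) (hv : ContDiff ℝ ∞ v) (q : smoothFunctions E) : smoothFunctions E :=
  ⟨fun x => fderiv ℝ q.1 x (v x),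
    ((contDiff_smooth q).fderiv_right (m := ∞) (by simp)).clm_apply hv⟩

lemma vectorField_mulSmooth (v : E → E) (hv : ContDiff ℝ ∞ v) (q : smoothFunctions E)
    (φ : 𝓓(Ω, ℝ)) :
    vectorField v hv (mulSmooth q φ) =
      mulSmooth (derivAlong v hv q) φ + mulSmooth q (vectorField v hv φ) := by
  ext x
  change fderiv ℝ (q.1 * ⇑φ) x (v x) = fderiv ℝ q.1 x (v x) * φ x + q.1 x * fderiv ℝ φ x (v x)
  rw [fderiv_mul (differentiableAt_smooth q x) (differentiableAt_test φ x)]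
  simp
  ring

lemma derivAlong_mul (v : E → E) (hv : ContDiff ℝ ∞ v) (p q : smoothFunctions E) :
    derivAlong v hv (p * q) = derivAlong v hv p * q + p * derivAlong v hv q := by
  ext x
  change fderiv ℝ (p.1 * q.1) x (v x) = fderiv ℝ p.1 x (v x) * q.1 x + p.1 x * fderiv ℝ q.1 x (v x)
  rw [fderiv_mul (differentiableAt_smooth p x) (differentiableAt_smooth q x)]
  simp
  ring

/-- Division of a test function by a smooth function that does not vanish on its support. -/
lemma exists_mulSmooth_eq (q : smoothFunctions E) (φ : 𝓓(Ω, ℝ)) (h : ∀ x ∈ tsupport φ, q.1 x ≠ 0) :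
    ∃ φ' : 𝓓(Ω, ℝ), tsupport φ' ⊆ tsupport φ ∧ mulSmooth q φ' = φ := by
  have hsupp : support (fun x => φ x / q.1 x) ⊆ support φ := by
    intro x hx
    contrapose! hx
    simp only [Function.mem_support, not_not] at hx ⊢
    simp [hx]
  have hts : tsupport (fun x => φ x / q.1 x) ⊆ tsupport φ := closure_mono hsupp
  refine ⟨⟨fun x => φ x / q.1 x, ?_, φ.hasCompactSupport.mono hsupp,
    hts.trans φ.tsupport_subset⟩, hts, ?_⟩
  · refine contDiff_iff_contDiffAt.2 fun x => ?_
    by_cases hx : x ∈ tsupport φ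
    · exact φ.contDiff.contDiffAt.div (contDiff_smooth q).contDiffAt (h x hx)
    · have : (fun x => φ x / q.1 x) =ᶠ[𝓝 x] fun _ => 0 := by
        filter_upwards [notMem_tsupport_iff_eventuallyEq.1 hx] with y hy
        simp [hy]
      exact contDiffAt_const.congr_of_eventuallyEq this
  · ext x
    by_cases hx : x ∈ tsupport φ
    · change q.1 x * (φ x / q.1 x) = φ x
      field_simp [h x hx]
    · have : φ x = 0 := image_eq_zero_of_notMem_tsupport hx
      change q.1 x * (φ x / q.1 x) = φ x
      simp [this]

end Calculus

/-! ### Local finiteness of order, and vanishing off the support. -/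

section Order

variable {E : Type*} [NormedAddCommGroup E] [NormedSpace ℝ E] {Ω : Opens E}

/-- On a compact set a distribution has finite order. -/
lemma exists_norm_apply_le (f : 𝓓'(Ω, ℂ)) {C : Set E} (hC : IsCompact C) (hCΩ : C ⊆ Ω) :
    ∃ (N : ℕ) (M : ℝ), 0 ≤ M ∧ ∀ (φ : 𝓓(Ω, ℝ)) (B : ℝ), tsupport φ ⊆ C → 0 ≤ B →
      (∀ i ≤ N, ∀ x ∈ C, ‖iteratedFDeriv ℝ i φ x‖ ≤ B) → ‖f φ‖ ≤ M * B := by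
  let K : Compacts E := ⟨C, hC⟩
  have hcont : Continuous (f ∘ TestFunction.ofSupportedIn (F := ℝ) (n := ⊤) (K := K) hCΩ) :=
    f.continuous.comp (TestFunction.continuous_ofSupportedIn _)
  let T : 𝓓^{⊤}_{K}(E, ℝ) →L[ℝ] ℂ :=
    f.comp (TestFunction.ofSupportedInCLM ℝ (F := ℝ) (n := ⊤) (K := K) hCΩ)
  let q : Seminorm ℝ 𝓓^{⊤}_{K}(E, ℝ) := (normSeminorm ℝ ℂ).comp T.toLinearMap
  have hq : Continuous q := continuous_norm.comp T.continuous
  obtain ⟨s, M, -, h⟩ := Seminorm.bound_of_continuous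
    (ContDiffMapSupportedIn.withSeminorms ℝ E ℝ ⊤ K) q hq
  refine ⟨s.sup id, M, M.2, fun φ B hφ hB hbd => ?_⟩
  let φ' : 𝓓^{⊤}_{K}(E, ℝ) :=
    .of_support_subset φ.contDiff (subset_closure.trans hφ)
  have h1 : ‖f φ‖ = q φ' := rfl
  have h2 := h φ'
  rw [h1]
  refine h2.trans ?_
  change (M : ℝ) * (s.sup (ContDiffMapSupportedIn.seminorm ℝ E ℝ ⊤ K)) φ' ≤ M * B
  refine mul_le_mul_of_nonneg_left ?_ M.2
  refine Seminorm.finset_sup_apply_le hB fun i hi => ?_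
  rw [ContDiffMapSupportedIn.seminorm_top_le_iff ℝ hB]
  intro x hx
  exact hbd i (Finset.le_sup (f := id) hi) x hx

variable [FiniteDimensional ℝ E]

open scoped Manifold in
/-- A distribution vanishes on the complement of its support. -/
lemma isVanishingOn_compl_dsupport (f : 𝓓'(Ω, ℂ)) : IsVanishingOn f (dsupport f)ᶜ := by
  intro φ hφ
  rw [dsupport_compl_eq] at hφ
  have hc : IsCompact (tsupport φ) := φ.hasCompactSupport
  rw [Set.sUnion_eq_iUnion] at hφ
  obtain ⟨t, ht⟩ := hc.elim_finite_subcover _ (fun i => i.2.2) hφ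
  -- A smooth partition of unity splits `φ` into pieces, each supported in a single open set on
  -- which `f` vanishes.
  obtain ⟨ρ, hρ⟩ := SmoothPartitionOfUnity.exists_isSubordinate 𝓘(ℝ, E) (isClosed_tsupport φ)
    (fun i : t => i.1.1) (fun i => i.1.2.2) (ht.trans (by
      intro x hx
      simp only [mem_iUnion] at hx ⊢
      obtain ⟨i, hi, hx⟩ := hx
      exact ⟨⟨i, hi⟩, hx⟩))
  let r : t → smoothFunctions E := fun i => ⟨ρ i, (ρ i).contMDiff.contDiff⟩
  have hsum : φ = ∑ i, mulSmooth (r i) φ := by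
    ext x
    have h1 : (∑ i, mulSmooth (r i) φ) x = (∑ i, ρ i x) * φ x := by
      have : (∑ i, mulSmooth (r i) φ) = mulSmooth (∑ i, r i) φ := by simp
      rw [this, mulSmooth_apply]
      congr 1
      simp [r]
    rw [h1]
    by_cases hx : x ∈ tsupport φ
    · have := ρ.sum_eq_one hx
      rw [finsum_eq_sum_of_fintype] at this
      rw [this, one_mul]
    · simp [image_eq_zero_of_notMem_tsupport hx]
  rw [hsum, map_sum]
  refine Finset.sum_eq_zero fun i _ => i.1.2.1 _ ?_
  exact (tsupport_mul_subset_left (f := (r i).1)).trans (hρ i)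

end Order

/-! ### Second order Taylor remainders with all derivatives in the space variable. -/

section Bounds

variable {E : Type*} [NormedAddCommGroup E] [NormedSpace ℝ E]

lemma exists_bound_iteratedFDeriv {G : Type*} [NormedAddCommGroup G] [NormedSpace ℝ G] {h : E → G}
    (hh : ContDiff ℝ ∞ h) {C : Set E} (hC : IsCompact C) (N : ℕ) :
    ∃ B : ℝ, 1 ≤ B ∧ ∀ i ≤ N, ∀ x ∈ C, ‖iteratedFDeriv ℝ i h x‖ ≤ B := by
  have h1 : ∀ i, ∃ B : ℝ, ∀ x ∈ C, ‖iteratedFDeriv ℝ i h x‖ ≤ B := fun i =>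
    hC.exists_bound_of_continuousOn
      (hh.continuous_iteratedFDeriv (m := i) (by exact_mod_cast le_top)).continuousOn
  choose B hB using h1
  refine ⟨1 + ∑ i ∈ Finset.range (N + 1), |B i|, ?_, fun i hi x hx => ?_⟩
  · have : 0 ≤ ∑ i ∈ Finset.range (N + 1), |B i| := Finset.sum_nonneg fun _ _ => abs_nonneg _
    linarith
  · have h2 := Finset.single_le_sum (f := fun i => |B i|) (fun _ _ => abs_nonneg _)
      (Finset.mem_range.2 (Nat.lt_succ_of_le hi))
    have h3 := hB i x hx
    have h4 := le_abs_self (B i)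
    linarith

lemma exists_norm_le_mul_sq {G : Type*} [NormedAddCommGroup G] [NormedSpace ℝ G] {F : ℝ × E → G}
    (hF : ContDiff ℝ ∞ F) (h0 : ∀ x, F (0, x) = 0) (h1 : ∀ x, fderiv ℝ F (0, x) (1, 0) = 0)
    {C : Set E} (hC : IsCompact C) :
    ∃ B : ℝ, 0 ≤ B ∧ ∀ t : ℝ, |t| ≤ 1 → ∀ x ∈ C, ‖F (t, x)‖ ≤ B * t ^ 2 := by
  set H : ℝ × E → G := fun y => fderiv ℝ F y (1, 0) with hH
  have hHs : ContDiff ℝ ∞ H := (hF.fderiv_right (m := ∞) (by simp)).clm_apply contDiff_const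
  have hderiv : ∀ {F' : ℝ × E → G}, ContDiff ℝ ∞ F' → ∀ (x : E) (t : ℝ),
      HasDerivAt (fun s : ℝ => F' (s, x)) (fderiv ℝ F' (t, x) (1, 0)) t := by
    intro F' hF' x t
    have h2 : HasFDerivAt F' (fderiv ℝ F' (t, x)) (t, x) :=
      (hF'.differentiable (by simp) _).hasFDerivAt
    have h3 : HasDerivAt (fun s : ℝ => (s, x)) ((1 : ℝ), (0 : E)) t :=
      (hasDerivAt_id t).prodMk (hasDerivAt_const t x)
    exact h2.comp_hasDerivAt t h3
  have hcont : Continuous fun y => fderiv ℝ H y (1, 0) :=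
    ((hHs.continuous_fderiv (by simp)).clm_apply continuous_const)
  obtain ⟨B, hB⟩ := ((isCompact_Icc (a := (-1 : ℝ)) (b := 1)).prod hC).exists_bound_of_continuousOn
    hcont.continuousOn
  refine ⟨|B|, abs_nonneg _, fun t ht x hx => ?_⟩
  have hmem : ∀ s ∈ Icc (-|t|) |t|, (s, x) ∈ Icc (-1 : ℝ) 1 ×ˢ C := fun s hs =>
    ⟨⟨by linarith [hs.1], by linarith [hs.2]⟩, hx⟩
  have h0' : (0 : ℝ) ∈ Icc (-|t|) |t| := ⟨by simp, by simp⟩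
  have htm : t ∈ Icc (-|t|) |t| := ⟨neg_abs_le t, le_abs_self t⟩
  have hHb : ∀ s ∈ Icc (-|t|) |t|, ‖H (s, x)‖ ≤ |B| * |t| := by
    intro s hs
    have h2 := (convex_Icc (-|t|) |t|).norm_image_sub_le_of_norm_hasDerivWithin_le
      (f := fun s => H (s, x)) (C := |B|) (fun s _ => (hderiv hHs x s).hasDerivWithinAt)
      (fun s hs => (hB _ (hmem s hs)).trans (le_abs_self B)) h0' hs
    have h3 : H (0, x) = 0 := h1 x
    simp only [h3, sub_zero, Real.norm_eq_abs] at h2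
    exact h2.trans (mul_le_mul_of_nonneg_left (abs_le.2 hs) (abs_nonneg _))
  have h2 := (convex_Icc (-|t|) |t|).norm_image_sub_le_of_norm_hasDerivWithin_le
    (f := fun s => F (s, x)) (C := |B| * |t|) (fun s _ => (hderiv hF x s).hasDerivWithinAt)
    hHb h0' htm
  simp only [h0, sub_zero, Real.norm_eq_abs] at h2
  rwa [mul_assoc, ← sq, sq_abs] at h2

lemma hasFDerivAt_slice {G : Type*} [NormedAddCommGroup G] [NormedSpace ℝ G] {F : ℝ × E → G}
    (hF : ContDiff ℝ ∞ F) (t : ℝ) (x : E) :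
    HasFDerivAt (fun y => F (t, y)) ((fderiv ℝ F (t, x)).comp (ContinuousLinearMap.inr ℝ ℝ E)) x := by
  have h2 : HasFDerivAt F (fderiv ℝ F (t, x)) (t, x) :=
    (hF.differentiable (by simp) _).hasFDerivAt
  exact h2.comp x (hasFDerivAt_prodMk_right t x)

lemma contDiff_fderiv_slice {G : Type*} [NormedAddCommGroup G] [NormedSpace ℝ G] {F : ℝ × E → G}
    (hF : ContDiff ℝ ∞ F) :
    ContDiff ℝ ∞ fun y : ℝ × E => (fderiv ℝ F y).comp (ContinuousLinearMap.inr ℝ ℝ E) :=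
  (hF.fderiv_right (m := ∞) (by simp)).clm_comp contDiff_const

lemma fderiv_slice_zero {G : Type*} [NormedAddCommGroup G] [NormedSpace ℝ G] {F : ℝ × E → G}
    (hF : ContDiff ℝ ∞ F) (h0 : ∀ x, F (0, x) = 0) (x : E) :
    (fderiv ℝ F (0, x)).comp (ContinuousLinearMap.inr ℝ ℝ E) = 0 := by
  rw [← (hasFDerivAt_slice hF 0 x).fderiv]
  simp [h0]

/-- By symmetry of the second derivative, differentiating in space preserves vanishing to second
order at `t = 0`. This is what makes induction on the order of the derivative possible. -/
lemma fderiv_fderiv_slice_zero {G : Type*} [NormedAddCommGroup G] [NormedSpace ℝ G]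
    {F : ℝ × E → G} (hF : ContDiff ℝ ∞ F) (h1 : ∀ x, fderiv ℝ F (0, x) (1, 0) = 0) (x : E) :
    fderiv ℝ (fun y : ℝ × E => (fderiv ℝ F y).comp (ContinuousLinearMap.inr ℝ ℝ E)) (0, x) (1, 0)
      = 0 := by
  have hF' : ContDiff ℝ ∞ (fderiv ℝ F) := hF.fderiv_right (m := ∞) (by simp)
  have hd : HasFDerivAt (fderiv ℝ F) (fderiv ℝ (fderiv ℝ F) (0, x)) (0, x) :=
    (hF'.differentiable (by simp) _).hasFDerivAt
  have hsymm : IsSymmSndFDerivAt ℝ F (0, x) :=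
    hF.contDiffAt.isSymmSndFDerivAt (by
      simp only [minSmoothness_of_isRCLikeNormedField]; exact WithTop.coe_le_coe.2 (le_top (a := (2 : ℕ∞))))
  ext v
  have h2 : HasFDerivAt (fun y : ℝ × E => (fderiv ℝ F y).comp (ContinuousLinearMap.inr ℝ ℝ E)) _
    (0, x) := hd.clm_comp (hasFDerivAt_const (ContinuousLinearMap.inr ℝ ℝ E) (0, x))
  rw [h2.fderiv]
  simp only [ContinuousLinearMap.comp_zero, zero_add, ContinuousLinearMap.comp_apply,
    zero_apply, ContinuousLinearMap.flip_apply,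
    ContinuousLinearMap.compL_apply, ContinuousLinearMap.inr_apply]
  rw [hsymm.eq]
  have h3 : ContDiff ℝ ∞ fun y => fderiv ℝ F y (1, 0) := hF'.clm_apply contDiff_const
  have h4 := fderiv_slice_zero h3 h1 x
  have h5 : fderiv ℝ (fun y => fderiv ℝ F y (1, 0)) (0, x) =
      (fderiv ℝ (fderiv ℝ F) (0, x)).flip (1, 0) := by
    rw [(hd.clm_apply (hasFDerivAt_const ((1 : ℝ), (0 : E)) (0, x))).fderiv]
    simp
  rw [h5] at h4
  simpa using congrArg (fun T => T v) h4

universe u in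
lemma exists_norm_iteratedFDeriv_le_mul_sq_aux {E : Type u} [NormedAddCommGroup E]
    [NormedSpace ℝ E] {C : Set E} (hC : IsCompact C) (i : ℕ) :
    ∀ {G : Type u} [NormedAddCommGroup G] [NormedSpace ℝ G] {F : ℝ × E → G}, ContDiff ℝ ∞ F →
      (∀ x, F (0, x) = 0) → (∀ x, fderiv ℝ F (0, x) (1, 0) = 0) →
      ∃ B : ℝ, 0 ≤ B ∧ ∀ t : ℝ, |t| ≤ 1 → ∀ x ∈ C,
        ‖iteratedFDeriv ℝ i (fun y => F (t, y)) x‖ ≤ B * t ^ 2 := by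
  induction i with
  | zero =>
    intro G _ _ F hF h0 h1
    simpa using exists_norm_le_mul_sq hF h0 h1 hC
  | succ i ih =>
    intro G _ _ F hF h0 h1
    obtain ⟨B, hB, h⟩ := ih (contDiff_fderiv_slice hF) (fderiv_slice_zero hF h0)
      (fderiv_fderiv_slice_zero hF h1)
    refine ⟨B, hB, fun t ht x hx => ?_⟩
    rw [← norm_iteratedFDeriv_fderiv]
    convert h t ht x hx using 4
    exact (hasFDerivAt_slice hF t _).fderiv

/-- The induction replaces the target `G` by `E →L[ℝ] G`, so it is run for targets in the universe
of `E`. One derivative taken by hand brings the target `ℝ` there. -/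
lemma exists_norm_iteratedFDeriv_le_mul_sq {F : ℝ × E → ℝ} (hF : ContDiff ℝ ∞ F)
    (h0 : ∀ x, F (0, x) = 0) (h1 : ∀ x, fderiv ℝ F (0, x) (1, 0) = 0)
    {C : Set E} (hC : IsCompact C) (i : ℕ) :
    ∃ B : ℝ, 0 ≤ B ∧ ∀ t : ℝ, |t| ≤ 1 → ∀ x ∈ C,
      ‖iteratedFDeriv ℝ i (fun y => F (t, y)) x‖ ≤ B * t ^ 2 := by
  cases i with
  | zero => simpa using exists_norm_le_mul_sq hF h0 h1 hC
  | succ i =>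
    obtain ⟨B, hB, h⟩ := exists_norm_iteratedFDeriv_le_mul_sq_aux hC i (contDiff_fderiv_slice hF)
      (fderiv_slice_zero hF h0) (fderiv_fderiv_slice_zero hF h1)
    refine ⟨B, hB, fun t ht x hx => ?_⟩
    rw [← norm_iteratedFDeriv_fderiv]
    convert h t ht x hx using 4
    exact (hasFDerivAt_slice hF t _).fderiv

end Bounds

/-! ### Differentiating a distribution along a linear flow. -/

section Flow

variable {E : Type*} [NormedAddCommGroup E] [NormedSpace ℝ E] {Ω : Opens E}

/-- The derivative at `t = 0` of the value of a distribution at `x ↦ φ (x + t L x)`. -/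
lemma hasDerivAt_apply_flow (f : 𝓓'(Ω, ℂ)) (L : E →L[ℝ] E) (φ : 𝓓(Ω, ℝ)) (Φ : ℝ → 𝓓(Ω, ℝ))
    (hΦ : ∀ t x, Φ t x = φ (x + t • L x)) {C : Set E} (hC : IsCompact C) (hCΩ : C ⊆ Ω)
    (hsupp : ∀ t, |t| ≤ 1 → tsupport (Φ t) ⊆ C) :
    HasDerivAt (fun t => f (Φ t)) (f (vectorField L L.contDiff φ)) 0 := by
  obtain ⟨N, M, hM, hf⟩ := exists_norm_apply_le f hC hCΩ
  set X := vectorField L L.contDiff φ with hX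
  have h00 : Φ 0 = φ := by ext x; simp [hΦ]
  have hφC : tsupport φ ⊆ C := h00 ▸ hsupp 0 (by simp)
  set F : ℝ × E → ℝ := fun y => φ (y.2 + y.1 • L y.2) - φ y.2 - y.1 * X y.2 with hFdef
  have hlin : ContDiff ℝ ∞ fun y : ℝ × E => y.2 + y.1 • L y.2 :=
    contDiff_snd.add (contDiff_fst.smul (L.contDiff.comp contDiff_snd))
  have hF : ContDiff ℝ ∞ F :=
    ((φ.contDiff.comp hlin).sub (φ.contDiff.comp contDiff_snd)).sub
      (contDiff_fst.mul (X.contDiff.comp contDiff_snd))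
  have hF0 : ∀ x, F (0, x) = 0 := by intro x; simp [hFdef]
  have hF1 : ∀ x, fderiv ℝ F (0, x) (1, 0) = 0 := by
    intro x
    have h3 : HasDerivAt (fun s : ℝ => (s, x)) ((1 : ℝ), (0 : E)) 0 :=
      (hasDerivAt_id 0).prodMk (hasDerivAt_const 0 x)
    have h4 := ((hF.differentiable (by simp) (0, x)).hasFDerivAt).comp_hasDerivAt (0 : ℝ) h3
    have h5 : HasDerivAt (fun t : ℝ => x + t • L x) (L x) 0 := by
      simpa using ((hasDerivAt_id (0 : ℝ)).smul_const (L x)).const_add x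
    have h6 : HasFDerivAt φ (fderiv ℝ φ x) (x + (0 : ℝ) • L x) := by
      simpa using (differentiableAt_test φ x).hasFDerivAt
    have h7 := ((h6.comp_hasDerivAt (0 : ℝ) h5).sub_const (φ x)).sub
      ((hasDerivAt_id (0 : ℝ)).mul_const (X x))
    have h8 := h4.unique h7
    rw [h8]
    simp [hX]
  have hb := fun i => exists_norm_iteratedFDeriv_le_mul_sq hF hF0 hF1 hC i
  choose B hB hB' using hb
  -- The remainder is `O(t²)` with all its derivatives of order at most `N`, the order of `f` on
  -- `C`, so `f` of it is `O(t²)` too.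
  have key : ∀ t : ℝ, |t| ≤ 1 →
      ‖f (Φ t) - f φ - t • f X‖ ≤ (M * ∑ i ∈ Finset.range (N + 1), B i) * t ^ 2 := by
    intro t ht
    have h1 : f (Φ t) - f φ - t • f X = f (Φ t - φ - t • X) := by simp
    rw [h1, mul_assoc]
    refine hf _ _ ?_ (mul_nonneg (Finset.sum_nonneg fun i _ => hB i) (sq_nonneg _)) ?_
    · refine (tsupport_sub _ _).trans (union_subset ((tsupport_sub _ _).trans
        (union_subset (hsupp t ht) hφC)) ?_)
      exact (tsupport_smul_subset_right (fun _ => t) _).trans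
        ((tsupport_vectorField_subset _ _ _).trans hφC)
    · intro i hi x hx
      have h2 : ((Φ t - φ - t • X : 𝓓(Ω, ℝ)) : E → ℝ) = fun y => F (t, y) := by
        ext y
        simp [hFdef, hΦ]
      rw [h2]
      refine (hB' i t ht x hx).trans (mul_le_mul_of_nonneg_right ?_ (sq_nonneg _))
      exact Finset.single_le_sum (fun i _ => hB i) (Finset.mem_range.2 (Nat.lt_succ_of_le hi))
  rw [hasDerivAt_iff_isLittleO_nhds_zero]
  have hO : (fun t : ℝ => f (Φ (0 + t)) - f (Φ 0) - t • f X) =O[𝓝 0] fun t : ℝ => t ^ 2 := by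
    refine Asymptotics.IsBigO.of_bound (M * ∑ i ∈ Finset.range (N + 1), B i) ?_
    filter_upwards [Metric.closedBall_mem_nhds (0 : ℝ) one_pos] with t ht
    rw [zero_add, h00]
    have := key t (by simpa using ht)
    simpa using this
  refine hO.trans_isLittleO ?_
  simpa using Asymptotics.isLittleO_pow_id (𝕜 := ℝ) (n := 2) (by norm_num)

end Flow

/-! ### Functions vanishing on the support are locally nilpotent on the distribution. -/

section Powers

variable {E : Type*} [NormedAddCommGroup E] [NormedSpace ℝ E] {Ω : Opens E}

/-- The rescalings `t⁻ᵐ g (t p)` have derivatives of order `≤ N` of size `O (tᴺ⁻ᵐ)`. -/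
lemma exists_bound_iteratedFDeriv_rescale {g : ℝ → ℝ} (hg : ContDiff ℝ ∞ g)
    (hgc : HasCompactSupport g) {p : E → ℝ} (hp : ContDiff ℝ ∞ p) {C : Set E} (hC : IsCompact C)
    (N : ℕ) :
    ∃ B : ℝ, 0 ≤ B ∧ ∀ t : ℝ, 1 ≤ t → ∀ i ≤ N, ∀ x ∈ C,
      ‖iteratedFDeriv ℝ i (fun y => g (t * p y)) x‖ ≤ B * t ^ N := by
  obtain ⟨D, hD1, hD⟩ := exists_bound_iteratedFDeriv hp hC N
  obtain ⟨A, hA1, hA⟩ := exists_bound_iteratedFDeriv hg hgc.isCompact N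
  have hA' : ∀ i ≤ N, ∀ s, ‖iteratedFDeriv ℝ i g s‖ ≤ A := by
    intro i hi s
    by_cases hs : s ∈ tsupport g
    · exact hA i hi s hs
    · have : iteratedFDeriv ℝ i g s = 0 := by
        by_contra h
        exact hs (support_iteratedFDeriv_subset (𝕜 := ℝ) i h)
      rw [this, norm_zero]
      linarith
  refine ⟨(Nat.factorial N : ℝ) * A * D ^ N, by positivity, fun t ht i hi x hx => ?_⟩
  have htp : ContDiff ℝ ∞ fun y => t * p y := contDiff_const.mul hp
  have h1 := norm_iteratedFDeriv_comp_le (n := i) (C := A) (D := t * D) hg htp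
    (by exact_mod_cast le_top) x
    (fun j hj => hA' j (hj.trans hi) _) (fun j hj1 hj => by
      have h2 : iteratedFDeriv ℝ j (fun y => t * p y) x = t • iteratedFDeriv ℝ j p x :=
        iteratedFDeriv_const_smul_apply (a := t) (f := p)
          (hp.contDiffAt.of_le (by exact_mod_cast le_top))
      rw [h2, norm_smul, Real.norm_of_nonneg (by linarith), mul_pow]
      refine mul_le_mul (le_self_pow₀ ht (by omega)) ?_ (norm_nonneg _) (by positivity)
      exact (hD j (hj.trans hi) x hx).trans (le_self_pow₀ hD1 (by omega)))
  refine h1.trans ?_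
  have h3 : (t * D) ^ i ≤ (t * D) ^ N :=
    pow_le_pow_right₀ (by nlinarith) hi
  have h4 : (Nat.factorial i : ℝ) ≤ Nat.factorial N := by exact_mod_cast Nat.factorial_le hi
  calc (Nat.factorial i : ℝ) * A * (t * D) ^ i ≤ (Nat.factorial N : ℝ) * A * (t * D) ^ N := by
        gcongr
    _ = _ := by rw [mul_pow]; ring

variable [FiniteDimensional ℝ E]

/-- On a compact set, some power of a smooth function vanishing on the support of a distribution
annihilates the distribution. -/
lemma exists_pow_annihilates (f : 𝓓'(Ω, ℂ)) {C : Set E} (hC : IsCompact C) (hCΩ : C ⊆ Ω)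
    (p : smoothFunctions E) (hp : ∀ x ∈ C, x ∈ dsupport f → p.1 x = 0) :
    ∃ N : ℕ, ∀ φ : 𝓓(Ω, ℝ), tsupport φ ⊆ C → f (mulSmooth (p ^ N) φ) = 0 := by
  obtain ⟨N, M, hM, hf⟩ := exists_norm_apply_le f hC hCΩ
  refine ⟨N + 1, fun φ hφ => ?_⟩
  let η : ContDiffBump (0 : ℝ) := ⟨1, 2, one_pos, one_lt_two⟩
  -- Since `η = 1` near zero, `p ^ (N + 1)` agrees with `t⁻¹ ^ (N + 1) * g (t p)` near the zeros of
  -- `p`, hence near the support. Derivatives of `g (t p)` up to the order `N` of `f` are `O(t ^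
  -- N)`. The exponent `N + 1` leaves a factor `t⁻¹`, which tends to zero.
  set g : ℝ → ℝ := fun s => s ^ (N + 1) * η s with hg
  have hgs : ContDiff ℝ ∞ g := (contDiff_id.pow _).mul η.contDiff
  have hgc : HasCompactSupport g := η.hasCompactSupport.mul_left
  have hps := contDiff_smooth p
  obtain ⟨A, hA0, hA⟩ := exists_bound_iteratedFDeriv_rescale hgs hgc hps hC N
  obtain ⟨D, hD1, hD⟩ := exists_bound_iteratedFDeriv φ.contDiff hC N
  let G : ℝ → smoothFunctions E := fun t =>
    ⟨fun x => g (t * p.1 x), hgs.comp (contDiff_const.mul hps)⟩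
  have heq : ∀ t : ℝ, 1 ≤ t →
      f (mulSmooth (p ^ (N + 1)) φ) = t⁻¹ ^ (N + 1) • f (mulSmooth (G t) φ) := by
    intro t ht
    have ht0 : t ≠ 0 := by positivity
    rw [← map_smul, ← sub_eq_zero, ← map_sub]
    refine isVanishingOn_compl_dsupport f _ ?_
    intro x hx hxf
    by_cases hxφ : x ∈ tsupport φ
    · have hpx : p.1 x = 0 := hp x (hφ hxφ) hxf
      refine absurd hx ?_
      rw [notMem_tsupport_iff_eventuallyEq]
      have hcont : Continuous fun y => t * p.1 y := (contDiff_const.mul hps).continuous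
      have : ∀ᶠ y in 𝓝 x, t * p.1 y ∈ Metric.ball (0 : ℝ) 1 :=
        hcont.continuousAt.eventually (Metric.isOpen_ball.mem_nhds (by simp [hpx]))
      filter_upwards [this] with y hy
      have h1 : η (t * p.1 y) = 1 := η.one_of_mem_closedBall (Metric.ball_subset_closedBall hy)
      change p.1 y ^ (N + 1) * φ y - t⁻¹ ^ (N + 1) * ((t * p.1 y) ^ (N + 1) * η (t * p.1 y) * φ y)
        = 0
      rw [h1, mul_pow, inv_pow]
      field_simp
      ring
    · refine absurd hx (fun h => hxφ ?_)
      refine ((tsupport_sub _ _).trans (union_subset (tsupport_mulSmooth_subset _ _) ?_)) h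
      exact (tsupport_smul_subset_right (fun _ => t⁻¹ ^ (N + 1)) _).trans
        (tsupport_mulSmooth_subset _ _)
  have hbound : ∀ t : ℝ, 1 ≤ t → ‖f (mulSmooth (p ^ (N + 1)) φ)‖ ≤ M * (2 ^ N * A * D) * t⁻¹ := by
    intro t ht
    have ht0 : 0 < t := by positivity
    rw [heq t ht, norm_smul]
    have h1 : ‖f (mulSmooth (G t) φ)‖ ≤ M * (2 ^ N * A * D * t ^ N) := by
      refine hf _ _ ((tsupport_mulSmooth_subset _ _).trans hφ) (by positivity) ?_
      intro i hi x hx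
      refine (norm_iteratedFDeriv_mul_le (contDiff_smooth (G t)) φ.contDiff x
        (by exact_mod_cast le_top)).trans ?_
      calc ∑ j ∈ Finset.range (i + 1), (i.choose j : ℝ) * ‖iteratedFDeriv ℝ j (G t).1 x‖ *
            ‖iteratedFDeriv ℝ (i - j) φ x‖
          ≤ ∑ j ∈ Finset.range (i + 1), (i.choose j : ℝ) * (A * t ^ N) * D := by
            refine Finset.sum_le_sum fun j hj => ?_
            have hj' : j ≤ i := Nat.lt_succ_iff.1 (Finset.mem_range.1 hj)
            have h2 := hA t ht j (hj'.trans hi) x hx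
            have h3 := hD (i - j) (by omega) x hx
            gcongr
        _ = 2 ^ i * (A * t ^ N) * D := by
            rw [← Finset.sum_mul, ← Finset.sum_mul]
            congr 2
            exact_mod_cast Nat.sum_range_choose i
        _ ≤ 2 ^ N * (A * t ^ N) * D := by
            gcongr
            norm_num
        _ = 2 ^ N * A * D * t ^ N := by ring
    calc ‖t⁻¹ ^ (N + 1)‖ * ‖f (mulSmooth (G t) φ)‖
        ≤ ‖t⁻¹ ^ (N + 1)‖ * (M * (2 ^ N * A * D * t ^ N)) := by gcongr
      _ = M * (2 ^ N * A * D) * t⁻¹ := by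
          rw [Real.norm_of_nonneg (by positivity), inv_pow, pow_succ]
          field_simp
  have hlim : Tendsto (fun t : ℝ => M * (2 ^ N * A * D) * t⁻¹) atTop (𝓝 0) := by
    simpa using tendsto_inv_atTop_zero.const_mul (M * (2 ^ N * A * D))
  have h0 : ‖f (mulSmooth (p ^ (N + 1)) φ)‖ ≤ 0 :=
    ge_of_tendsto hlim ((eventually_ge_atTop 1).mono hbound)
  exact norm_le_zero_iff.1 h0

end Powers

/-! ### Annihilating functions and their two uses: variable coefficients and noncharacteristic
vanishing. -/

section Annihilators

variable {E : Type*} [NormedAddCommGroup E] [NormedSpace ℝ E] {Ω : Opens E}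

/-- The smooth function `q` annihilates the linear form `F` on test functions supported in `C`. -/
def Annihilates (C : Set E) (q : smoothFunctions E) (F : 𝓓(Ω, ℝ) →ₗ[ℝ] ℂ) : Prop :=
  ∀ φ : 𝓓(Ω, ℝ), tsupport φ ⊆ C → F (mulSmooth q φ) = 0

lemma isVanishingOn_of_annihilates {C : Set E} {q : smoothFunctions E}
    {F : 𝓓(Ω, ℝ) →ₗ[ℝ] ℂ} (h : Annihilates C q F) (hq : ∀ x ∈ C, q.1 x ≠ 0) :
    IsVanishingOn F C := by
  intro φ hφ
  obtain ⟨φ', hφ', rfl⟩ := exists_mulSmooth_eq q φ fun x hx => hq x (hφ hx)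
  exact h φ' (hφ'.trans hφ)

lemma annihilates_one_iff {C : Set E} {F : 𝓓(Ω, ℝ) →ₗ[ℝ] ℂ} :
    Annihilates C 1 F ↔ IsVanishingOn F C := by
  simp [Annihilates, IsVanishingOn]

/-- If finitely many functions are nilpotent on a nonzero linear form, then some multiple of the
linear form by a product of these functions is nonzero and annihilated by all of them. -/
lemma exists_mul_annihilates {C : Set E} {F : 𝓓(Ω, ℝ) →ₗ[ℝ] ℂ} (hF : ¬ IsVanishingOn F C)
    (s : Finset (smoothFunctions E)) (hs : ∀ q ∈ s, ∃ N : ℕ, Annihilates C (q ^ N) F) :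
    ∃ Q ∈ Submonoid.closure (s : Set (smoothFunctions E)),
      ¬ IsVanishingOn (F ∘ₗ mulSmooth Q) C ∧ ∀ q ∈ s, Annihilates C q (F ∘ₗ mulSmooth Q) := by
  classical
  induction s using Finset.induction_on with
  | empty => exact ⟨1, Submonoid.one_mem _, by simpa [IsVanishingOn] using hF, by simp⟩
  | insert a s ha ih =>
    obtain ⟨Q, hQ, hQF, hQs⟩ := ih fun q hq => hs q (Finset.mem_insert_of_mem hq)
    have hex : ∃ n : ℕ, Annihilates C (a ^ n) (F ∘ₗ mulSmooth Q) := by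
      obtain ⟨N, hN⟩ := hs a (Finset.mem_insert_self _ _)
      refine ⟨N, fun φ hφ => ?_⟩
      have h1 := hN (mulSmooth Q φ) ((tsupport_mulSmooth_subset _ _).trans hφ)
      rwa [← Module.End.mul_apply, ← map_mul, mul_comm, map_mul] at h1
    -- For the least exponent `n`, the factor to add is `a ^ (n - 1)`: by minimality the new form is
    -- nonzero, and `a` kills it. The case `n = 0` would say that the old form vanishes.
    have hn := Nat.find_spec hex
    have hmin := fun m => Nat.find_min hex (m := m)
    set n := Nat.find hex
    cases hn' : n with
    | zero =>
      rw [hn', pow_zero, annihilates_one_iff] at hn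
      exact absurd hn hQF
    | succ m =>
      have hm := hmin m (by omega)
      rw [hn'] at hn
      have hcl : ∀ q ∈ (s : Set (smoothFunctions E)), q ∈ ((insert a s : Finset _) : Set _) :=
        fun q hq => Finset.mem_insert_of_mem hq
      refine ⟨Q * a ^ m, Submonoid.mul_mem _ (Submonoid.closure_mono hcl hQ)
        (Submonoid.pow_mem _ (Submonoid.subset_closure (Finset.mem_insert_self _ _)) _), ?_, ?_⟩
      · intro h
        refine hm fun φ hφ => ?_
        have := h φ hφ
        rwa [map_mul] at this
      · intro q hq φ hφ
        rcases Finset.mem_insert.1 hq with rfl | hq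
        · have := hn φ hφ
          rwa [pow_succ, LinearMap.comp_apply, map_mul, Module.End.mul_apply,
            ← Module.End.mul_apply (mulSmooth Q), ← map_mul] at this
        · have := hQs q hq (mulSmooth (a ^ m) φ) ((tsupport_mulSmooth_subset _ _).trans hφ)
          rw [LinearMap.comp_apply, ← Module.End.mul_apply, ← Module.End.mul_apply, ← map_mul,
            ← map_mul] at this
          rw [LinearMap.comp_apply, ← Module.End.mul_apply, ← map_mul]
          rwa [show Q * a ^ m * q = Q * q * a ^ m by ring]

/-- A linear form that is an eigenvector of the vector fields `V i` is an eigenvector of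
combinations of the `V i` with variable coefficients, modulo the functions annihilating it. -/
lemma apply_vectorField_combination {ι κ : Type*} [Fintype ι] [Fintype κ] {C : Set E}
    {F : 𝓓(Ω, ℝ) →ₗ[ℝ] ℂ} (V : ι → E → E) (hV : ∀ i, ContDiff ℝ ∞ (V i)) (l : ι → ℝ)
    (heig : ∀ i φ, F (vectorField (V i) (hV i) φ) = Complex.I * (l i • F φ))
    (c : ι → smoothFunctions E) (W : κ → E → E) (hW : ∀ k, ContDiff ℝ ∞ (W k))
    (h : κ → smoothFunctions E) (hh : ∀ k, Annihilates C (h k) F)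
    (U : E → E) (hU : ContDiff ℝ ∞ U)
    (hsum : ∀ x, U x = ∑ i, (c i).1 x • V i x + ∑ k, (h k).1 x • W k x)
    (a : κ → ℝ) (hdiv : ∀ x, ∑ i, fderiv ℝ (c i).1 x (V i x) = ∑ k, a k * (h k).1 x)
    (φ : 𝓓(Ω, ℝ)) (hφ : tsupport φ ⊆ C) :
    F (vectorField U hU φ) = Complex.I * F (mulSmooth (∑ i, l i • c i) φ) := by
  -- Move each coefficient inside its field by `c V φ = V (c φ) - (V c) φ`. By `hdiv` the total
  -- divergence term is a combination of the `h k`, so `F` does not see it.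
  have h1 : vectorField U hU φ = ∑ i, vectorField (V i) (hV i) (mulSmooth (c i) φ)
      - ∑ k, a k • mulSmooth (h k) φ
      + ∑ k, mulSmooth (h k) (vectorField (W k) (hW k) φ) := by
    have h2 : ∑ i, mulSmooth (derivAlong (V i) (hV i) (c i)) φ = ∑ k, a k • mulSmooth (h k) φ := by
      have : ∑ i, derivAlong (V i) (hV i) (c i) = ∑ k, a k • h k := by
        ext x
        simpa [derivAlong] using hdiv x
      calc _ = mulSmooth (∑ i, derivAlong (V i) (hV i) (c i)) φ := by simp
        _ = _ := by rw [this]; simp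
    have h3 : vectorField U hU φ = ∑ i, mulSmooth (c i) (vectorField (V i) (hV i) φ) +
        ∑ k, mulSmooth (h k) (vectorField (W k) (hW k) φ) := by
      ext x
      simp [hsum]
    rw [h3, ← h2]
    simp only [vectorField_mulSmooth, Finset.sum_add_distrib]
    abel
  have h4 : ∑ k, a k • F (mulSmooth (h k) φ) = 0 :=
    Finset.sum_eq_zero fun k _ => by rw [hh k φ hφ, smul_zero]
  have h5 : ∑ k, F (mulSmooth (h k) (vectorField (W k) (hW k) φ)) = 0 :=
    Finset.sum_eq_zero fun k _ => hh k _ ((tsupport_vectorField_subset _ _ _).trans hφ)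
  rw [h1, map_add, map_sub, map_sum, map_sum, map_sum]
  simp only [map_smul, heig, h4, h5]
  simp [Finset.mul_sum]

/-- A linear form annihilated by a power of a function `p` whose level sets are noncharacteristic
for a second order operator `∑ B i ∘ A i`, of which it is an eigenvector, vanishes. -/
lemma isVanishingOn_of_noncharacteristic {ι : Type*} [Fintype ι] {C : Set E}
    {F : 𝓓(Ω, ℝ) →ₗ[ℝ] ℂ} (A B : ι → E → E) (hA : ∀ i, ContDiff ℝ ∞ (A i))
    (hB : ∀ i, ContDiff ℝ ∞ (B i)) {μ : ℂ}
    (heig : ∀ φ, F (∑ i, vectorField (B i) (hB i) (vectorField (A i) (hA i) φ)) = μ * F φ)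
    (p : smoothFunctions E) {N : ℕ} (hN : Annihilates C (p ^ N) F)
    (hp : ∀ x ∈ C, ∑ i, fderiv ℝ p.1 x (A i x) * fderiv ℝ p.1 x (B i x) ≠ 0) :
    IsVanishingOn F C := by
  classical
  have hex : ∃ n : ℕ, Annihilates C (p ^ n) F := ⟨N, hN⟩
  have hn := Nat.find_spec hex
  have hmin := fun m => Nat.find_min hex (m := m)
  set n := Nat.find hex
  cases hn' : n with
  | zero => rwa [hn', pow_zero, annihilates_one_iff] at hn
  | succ k =>
    exfalso
    rw [hn'] at hn
    refine hmin k (by omega) ?_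
    let Γ : smoothFunctions E := ∑ i, derivAlong (A i) (hA i) p * derivAlong (B i) (hB i) p
    have hΓ : ∀ x, Γ.1 x = ∑ i, fderiv ℝ p.1 x (A i x) * fderiv ℝ p.1 x (B i x) := by
      intro x
      simp [Γ, derivAlong]
    have key : ∀ φ : 𝓓(Ω, ℝ), tsupport φ ⊆ C → F (mulSmooth (p ^ k) (mulSmooth Γ φ)) = 0 := by
      intro φ hφ
      have hpow : ∀ (v : E → E) (hv : ContDiff ℝ ∞ v) (m : ℕ), derivAlong v hv (p ^ (m + 1)) =
          ((m : ℝ) + 1) • (p ^ m * derivAlong v hv p) := by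
        intro v hv m
        induction m with
        | zero => simp
        | succ m ih =>
          rw [pow_succ, derivAlong_mul, ih]
          ext x
          simp
          ring
      -- Expand `B i (A i (p ^ (k + 2) φ))` by the Leibniz rule. Here `ψ i` is the cofactor of the
      -- terms divisible by `p ^ (k + 1)`, all of them killed. The only other term is `(k + 2) (k +
      -- 1) p ^ k (A i p) (B i p) φ`, so the eigenvalue equation shows that `p ^ k Γ` annihilates
      -- `F`. As `Γ` is invertible on `C`, this contradicts the minimality of `k + 1`.
      let ψ : ι → 𝓓(Ω, ℝ) := fun i =>
        ((k : ℝ) + 2) • mulSmooth (derivAlong (B i) (hB i) (derivAlong (A i) (hA i) p)) φ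
        + ((k : ℝ) + 2) • mulSmooth (derivAlong (A i) (hA i) p) (vectorField (B i) (hB i) φ)
        + ((k : ℝ) + 2) • mulSmooth (derivAlong (B i) (hB i) p) (vectorField (A i) (hA i) φ)
        + mulSmooth p (vectorField (B i) (hB i) (vectorField (A i) (hA i) φ))
      have hann : ∀ (q : smoothFunctions E) (χ : 𝓓(Ω, ℝ)), tsupport χ ⊆ C →
          F (mulSmooth (p ^ (k + 1)) (mulSmooth q χ)) = 0 :=
        fun q χ hχ => hn _ ((tsupport_mulSmooth_subset _ _).trans hχ)
      have hVA := fun i => (tsupport_vectorField_subset (A i) (hA i) φ).trans hφ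
      have hVB := fun i => (tsupport_vectorField_subset (B i) (hB i) φ).trans hφ
      have hVBA := fun i => (tsupport_vectorField_subset (B i) (hB i) _).trans (hVA i)
      have hψ : ∀ i, F (mulSmooth (p ^ (k + 1)) (ψ i)) = 0 := by
        intro i
        simp only [ψ, map_add, map_smul, hann _ _ hφ, hann _ _ (hVA i), hann _ _ (hVB i),
          hann _ _ (hVBA i), smul_zero, add_zero]
      have hexp : ∑ i, vectorField (B i) (hB i) (vectorField (A i) (hA i)
            (mulSmooth (p ^ (k + 1 + 1)) φ)) =
          ∑ i, mulSmooth (p ^ (k + 1)) (ψ i) +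
            (((k : ℝ) + 2) * ((k : ℝ) + 1)) • mulSmooth (p ^ k) (mulSmooth Γ φ) := by
        have hΓ' : mulSmooth Γ φ =
            ∑ i, mulSmooth (derivAlong (A i) (hA i) p * derivAlong (B i) (hB i) p) φ := by
          simp [Γ]
        rw [hΓ', map_sum, Finset.smul_sum, ← Finset.sum_add_distrib]
        refine Finset.sum_congr rfl fun i _ => ?_
        have hconst : ∀ (r : ℝ) (q : smoothFunctions E),
            derivAlong (B i) (hB i) (r • q) = r • derivAlong (B i) (hB i) q := by
          intro r q
          ext x
          change fderiv ℝ (r • q.1) x (B i x) = r * fderiv ℝ q.1 x (B i x)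
          rw [fderiv_const_smul (differentiableAt_smooth q x)]
          rfl
        rw [vectorField_mulSmooth, map_add, vectorField_mulSmooth, vectorField_mulSmooth, hpow,
          hpow, hconst, derivAlong_mul, hpow]
        ext x
        simp [ψ, -map_pow, -map_mul]
        ring
      have h1 := heig (mulSmooth (p ^ (k + 1 + 1)) φ)
      have h2 : F (mulSmooth (p ^ (k + 1 + 1)) φ) = 0 := by
        rw [pow_succ, map_mul]
        exact hann _ _ hφ
      rw [hexp, h2, map_add, map_sum, Finset.sum_eq_zero (fun i _ => hψ i), zero_add, map_smul,
        mul_zero] at h1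
      exact (smul_eq_zero.1 h1).resolve_left (by positivity)
    intro φ hφ
    obtain ⟨φ', hφ', rfl⟩ := exists_mulSmooth_eq Γ φ fun x hx => by
      rw [hΓ]; exact hp x (hφ hx)
    exact key φ' (hφ'.trans hφ)

end Annihilators

/-! ### The logarithmic derivative of the additive character. -/

section Character

variable {K : Type*} [RCLike K]

/-- A differentiable unitary additive character has a purely imaginary linear logarithmic
derivative, which is nonzero if the character is nontrivial. -/
lemma exists_logDeriv_addChar (ψ : AddChar K Circle) (hψ : ψ ≠ 1)
    (hd : ∀ z : K, ∃ d : ℂ, HasDerivAt (fun t : ℝ => (ψ (t • z) : ℂ)) d 0) :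
    ∃ κ : K →ₗ[ℝ] ℝ, κ ≠ 0 ∧
      ∀ z : K, HasDerivAt (fun t : ℝ => (ψ (t • z) : ℂ)) (Complex.I * κ z) 0 := by
  choose d hd using hd
  have hadd : ∀ z w, d (z + w) = d z + d w := by
    intro z w
    have h1 := (hd z).mul (hd w)
    simp only [zero_smul, AddChar.map_zero_eq_one, Circle.coe_one, mul_one, one_mul] at h1
    refine (hd (z + w)).unique (h1.congr_of_eventuallyEq (Eventually.of_forall fun t => ?_))
    simp [smul_add, AddChar.map_add_eq_mul]
  have hsmul : ∀ (r : ℝ) z, d (r • z) = r • d z := by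
    intro r z
    have h0 : HasDerivAt (fun t : ℝ => (ψ (t • z) : ℂ)) (d z) (0 * r) := by simpa using hd z
    have h1 := h0.scomp (0 : ℝ) ((hasDerivAt_id (0 : ℝ)).mul_const r)
    refine (hd (r • z)).unique ?_
    rw [one_mul] at h1
    refine h1.congr_of_eventuallyEq (Eventually.of_forall fun t => ?_)
    simp [smul_smul]
  -- Unitarity makes the conjugate of `ψ (t z)` equal to `ψ (-t z)`, so `conj (d z) = -d z`.
  have hre : ∀ z, (d z).re = 0 := by
    intro z
    have h1 : HasDerivAt (fun t : ℝ => (starRingEnd ℂ) (ψ (t • z) : ℂ))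
        ((starRingEnd ℂ) (d z)) 0 :=
      Complex.conjCLE.toContinuousLinearMap.hasFDerivAt.comp_hasDerivAt (0 : ℝ) (hd z)
    have h2 := (hd ((-1 : ℝ) • z)).unique (h1.congr_of_eventuallyEq
      (Eventually.of_forall fun t => by
        simp only [smul_neg, neg_smul, one_smul, AddChar.map_neg_eq_inv, ← Circle.coe_inv_eq_conj]))
    rw [hsmul] at h2
    have := congrArg Complex.re h2
    simp at this
    linarith
  have hI : ∀ z, Complex.I * ((d z).im : ℂ) = d z := by
    intro z
    apply Complex.ext <;> simp [hre]
  refine ⟨{ toFun := fun z => (d z).im, map_add' := fun z w => by simp [hadd],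
            map_smul' := fun r z => by simp [hsmul] }, fun h => hψ ?_, fun z => ?_⟩
  · have hd0 : ∀ z, d z = 0 := by
      intro z
      have : (d z).im = 0 := LinearMap.congr_fun h z
      rw [← hI, this]
      simp
    ext z
    have hder : ∀ t : ℝ, HasDerivAt (fun t : ℝ => (ψ (t • z) : ℂ)) 0 t := by
      intro t
      have h1 : HasDerivAt (fun s : ℝ => (ψ (s • z) : ℂ)) 0 (t - t) := by
        simpa [hd0] using hd z
      have h2 := (h1.comp_sub_const t t).const_mul (ψ (t • z) : ℂ)
      rw [mul_zero] at h2
      refine h2.congr_of_eventuallyEq (Eventually.of_forall fun s => ?_)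
      change (ψ (s • z) : ℂ) = (ψ (t • z) : ℂ) * (ψ ((s - t) • z) : ℂ)
      rw [← Circle.coe_mul, ← AddChar.map_add_eq_mul, ← add_smul, add_sub_cancel]
    have := is_const_of_deriv_eq_zero (fun t => (hder t).differentiableAt)
      (fun t => (hder t).deriv) 1 0
    simpa using this
  · rw [LinearMap.coe_mk, AddHom.coe_mk, hI]
    exact hd z

end Character

/-! ### Unipotent elements of `S` and their characters. -/

section Unipotent

variable {K : Type*} [RCLike K]

/-- The block subdiagonal shift. -/
def shift (K : Type*) [RCLike K] : Mat K := Matrix.of fun i j => if i.val = j.val + 2 then 1 else 0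

/-- The projection onto the block rows of index at least `k`. -/
def lowerProj (K : Type*) [RCLike K] (k : ℕ) : Mat K :=
  Matrix.diagonal fun i => if 2 * k ≤ i.val then 1 else 0

lemma lowerProj_mul_apply (k : ℕ) (x : Mat K) (i j : Fin 6) :
    (lowerProj K k * x) i j = if 2 * k ≤ i.val then x i j else 0 := by
  simp [lowerProj, Matrix.diagonal_mul]

lemma mul_lowerProj_apply (k : ℕ) (x : Mat K) (i j : Fin 6) :
    (x * lowerProj K k) i j = if 2 * k ≤ j.val then x i j else 0 := by
  simp [lowerProj, Matrix.mul_diagonal]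

lemma lowerProj_mul_self (k : ℕ) : lowerProj K k * lowerProj K k = lowerProj K k := by
  ext i j
  rw [lowerProj_mul_apply]
  simp only [lowerProj, Matrix.diagonal_apply]
  split_ifs <;> rfl

lemma lowerProj_transpose (k : ℕ) : (lowerProj K k).transpose = lowerProj K k := by
  simp [lowerProj]

lemma block_apply (i j : Fin 3) (x : Mat K) (r s : Fin 2) :
    block i j x r s = x ⟨r.val + 2 * i.val, by omega⟩ ⟨s.val + 2 * j.val, by omega⟩ := rfl

lemma apply_eq_zero_of_unipotent {k : ℕ} {ξ : Mat K} (h1 : lowerProj K k * ξ = 0)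
    (h2 : ξ * lowerProj K k = ξ) (i j : Fin 6) (h : ¬ (i.val < 2 * k ∧ 2 * k ≤ j.val)) :
    ξ i j = 0 := by
  by_cases hi : 2 * k ≤ i.val
  · have := congrFun (congrFun h1 i) j
    rwa [lowerProj_mul_apply, if_pos hi] at this
  · have := congrFun (congrFun h2 i) j
    rw [mul_lowerProj_apply, if_neg (by omega)] at this
    exact this.symm

lemma blocks_strictUpper {B : Matrix (Fin 3) (Fin 3) (Mat2 K)} (hB : ∀ i j, j ≤ i → B i j = 0) :
    1 + B = !![1, B 0 1, B 0 2; 0, 1, B 1 2; 0, 0, 1] := by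
  rw [← blocks_one]
  conv_lhs => rw [Matrix.eta_fin_three B]
  rw [hB 0 0 le_rfl, hB 1 0 (by decide), hB 1 1 le_rfl, hB 2 0 (by decide), hB 2 1 (by decide),
    hB 2 2 le_rfl]
  generalize B 0 1 = b, B 0 2 = d, B 1 2 = c
  simp

lemma one_add_eq_ofBlocks {k : ℕ} {ξ : Mat K}
    (h1 : lowerProj K k * ξ = 0) (h2 : ξ * lowerProj K k = ξ) :
    1 + ξ = ofBlocks K (!![1, block 0 1 ξ, block 0 2 ξ; 0, 1, block 1 2 ξ; 0, 0, 1]) := by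
  have hz : ∀ i j : Fin 3, j ≤ i → (ofBlocks K).symm ξ i j = 0 := by
    intro i j hij
    ext r s
    change block i j ξ r s = 0
    rw [block_apply]
    refine apply_eq_zero_of_unipotent h1 h2 _ _ fun h => ?_
    have := r.2
    have := s.2
    have : j.val ≤ i.val := hij
    obtain ⟨h3, h4⟩ := h
    dsimp only at h3 h4
    omega
  have h := congrArg (ofBlocks K) (blocks_strictUpper hz)
  rw [map_add, map_one, (ofBlocks K).apply_symm_apply ξ] at h
  unfold block
  exact h

lemma trace_shift_mul (ξ : Mat K) :
    (shift K * ξ).trace = (block 0 1 ξ + block 1 2 ξ).trace := by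
  have h : ∀ i : Fin 6, (shift K * ξ) i i = ∑ j : Fin 6, if i.val = j.val + 2 then ξ j i else 0 := by
    intro i
    simp [Matrix.mul_apply, shift]
  rw [Matrix.trace_add, Matrix.trace_fin_two, Matrix.trace_fin_two]
  change ∑ i, (shift K * ξ) i i = ξ 0 2 + ξ 1 3 + (ξ 2 4 + ξ 3 5)
  simp only [h, Fin.sum_univ_six]
  simp
  ring

/-- The element `1 + ξ` of `S`, for `ξ` in the Lie algebra of the unipotent radical of a maximal
parabolic. -/
lemma exists_unipotent (χ : Kˣ →* ℂˣ) (ψ : AddChar K Circle) {k : ℕ} {ξ : Mat K}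
    (h1 : lowerProj K k * ξ = 0) (h2 : ξ * lowerProj K k = ξ) :
    ∃ s : S K, s.1.val = 1 + ξ ∧ (s.1⁻¹ : GL (Fin 6) K).val = 1 - ξ ∧
      (chiS χ ψ s : ℂ) = ψ (shift K * ξ).trace := by
  have hsq : ξ * ξ = 0 := by
    nth_rewrite 1 [← h2]
    rw [mul_assoc, h1, mul_zero]
  let g : GL (Fin 6) K := ⟨1 + ξ, 1 - ξ, by simp [mul_sub, add_mul, hsq],
    by simp [mul_add, sub_mul, hsq]⟩
  have hg := one_add_eq_ofBlocks h1 h2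
  refine ⟨⟨g, 1, _, _, _, hg⟩, rfl, rfl, ?_⟩
  rw [chiS_apply χ ψ _ 1 (block 0 1 ξ) (block 1 2 ξ) (block 0 2 ξ), trace_shift_mul]
  · simp
  · change 1 + ξ = _
    rw [hg]
    congr 1
    simp only [Units.val_one]
    rw [blocks_one, mul_one]

end Unipotent

/-! ### From equivariance to eigenvalue equations for vector fields. -/

section Infinitesimal

variable {K : Type*} [RCLike K]

/-- Left multiplication by a matrix, as a continuous linear map. -/
def mulLeftL (ξ : Mat K) : Mat K →L[ℝ] Mat K :=
  LinearMap.toContinuousLinearMap (LinearMap.mulLeft ℝ ξ)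

/-- Right multiplication by a matrix, as a continuous linear map. -/
def mulRightL (η : Mat K) : Mat K →L[ℝ] Mat K :=
  LinearMap.toContinuousLinearMap (LinearMap.mulRight ℝ η)

@[simp] lemma mulLeftL_apply (ξ x : Mat K) : mulLeftL ξ x = ξ * x := rfl

@[simp] lemma mulRightL_apply (η x : Mat K) : mulRightL η x = x * η := rfl

/-- The supports of the translated test functions for `|t| ≤ 1` sweep out a compact set, which stays
inside `GLOpen K` because the action preserves invertibility. So `hasDerivAt_apply_flow` applies. -/
lemma hasDerivAt_pushTest (f : 𝓓'(GLOpen K, ℂ)) (L : Mat K →L[ℝ] Mat K) (g h : ℝ → GL (Fin 6) K)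
    (hinv : ∀ t x, act (g t)⁻¹ (h t)⁻¹ x = x + t • L x)
    (hfwd : ∀ t x, act (g t) (h t) x = x - t • L x) (φ : 𝓓(GLOpen K, ℝ)) :
    HasDerivAt (fun t => f (pushTest (g t) (h t) φ)) (f (vectorField L L.contDiff φ)) 0 := by
  have hcont : Continuous fun y : ℝ × Mat K => y.2 - y.1 • L y.2 :=
    continuous_snd.sub (continuous_fst.smul (L.continuous.comp continuous_snd))
  have hC : IsCompact ((fun y : ℝ × Mat K => y.2 - y.1 • L y.2) '' (Icc (-1) 1 ×ˢ tsupport φ)) :=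
    ((isCompact_Icc (a := (-1 : ℝ)) (b := 1)).prod φ.hasCompactSupport).image hcont
  refine hasDerivAt_apply_flow f L φ _ (fun t x => ?_) hC ?_ fun t ht x hx => ?_
  · change φ (act (g t)⁻¹ (h t)⁻¹ x) = _
    rw [hinv]
  · rintro _ ⟨⟨t, x⟩, ⟨-, hx⟩, rfl⟩
    change (x - t • L x).det ≠ 0
    rw [← hfwd]
    exact (det_act_ne_zero_iff _ _ _).2 (φ.tsupport_subset hx)
  · have h1 : act (g t)⁻¹ (h t)⁻¹ x ∈ tsupport φ :=
      tsupport_comp_subset_preimage φ (actEquiv (g t)⁻¹ (h t)⁻¹).continuous hx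
    refine ⟨(t, act (g t)⁻¹ (h t)⁻¹ x), ⟨abs_le.1 ht, h1⟩, ?_⟩
    change act (g t)⁻¹ (h t)⁻¹ x - t • L (act (g t)⁻¹ (h t)⁻¹ x) = x
    rw [← hfwd]
    exact (actEquiv (g t) (h t)).right_inv x

variable {χ : Kˣ →* ℂˣ} {ψ : AddChar K Circle} {f : 𝓓'(GLOpen K, ℂ)}

/-- The action of `1 - t ξ` on `f` is computed twice: equivariance yields the character value, the
flow yields the vector field. The sign is there because a push-forward composes with the inverse,
and `ξ² = 0` makes that inverse `1 + t ξ`. -/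
lemma hasDerivAt_left (hf : IsEquivariant χ ψ f) {k : ℕ} {ξ : Mat K}
    (h1 : lowerProj K k * ξ = 0) (h2 : ξ * lowerProj K k = ξ) (φ : 𝓓(GLOpen K, ℝ)) :
    HasDerivAt (fun t : ℝ => (ψ (t • -(shift K * ξ).trace) : ℂ) * f φ)
      (f (vectorField (mulLeftL ξ) (mulLeftL ξ).contDiff φ)) 0 := by
  have hs : ∀ t : ℝ, ∃ s : S K, s.1.val = 1 + (-t) • ξ ∧ (s.1⁻¹ : GL (Fin 6) K).val = 1 - (-t) • ξ ∧
      (chiS χ ψ s : ℂ) = ψ (shift K * ((-t) • ξ)).trace := fun t =>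
    exists_unipotent χ ψ (by rw [mul_smul_comm, h1, smul_zero]) (by rw [smul_mul_assoc, h2])
  choose s hs1 hs2 hs3 using hs
  have h := hasDerivAt_pushTest f (mulLeftL ξ) (fun t => (s t).1) (fun _ => (1 : S K).1)
    (fun t x => by simp [act, hs2, add_mul]) (fun t x => by simp [act, hs1, add_mul]; abel) φ
  refine h.congr_of_eventuallyEq (Eventually.of_forall fun t => ?_)
  have h3 := LinearMap.congr_fun (hf (s t) 1) φ
  change f (pushTest (s t).1 (1 : S K).1 φ) = _ * f φ at h3
  change _ = f (pushTest (s t).1 (1 : S K).1 φ)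
  rw [h3, hs3]
  simp [Matrix.trace_smul]

lemma hasDerivAt_right (hf : IsEquivariant χ ψ f) {k : ℕ} {η : Mat K}
    (h1 : lowerProj K k * η = η) (h2 : η * lowerProj K k = 0) (φ : 𝓓(GLOpen K, ℝ)) :
    HasDerivAt (fun t : ℝ => (ψ (t • -((shift K).transpose * η).trace) : ℂ) * f φ)
      (f (vectorField (mulRightL η) (mulRightL η).contDiff φ)) 0 := by
  have hs : ∀ t : ℝ, ∃ s : S K, s.1.val = 1 + (-t) • η.transpose ∧
      (s.1⁻¹ : GL (Fin 6) K).val = 1 - (-t) • η.transpose ∧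
      (chiS χ ψ s : ℂ) = ψ (shift K * ((-t) • η.transpose)).trace := fun t =>
    exists_unipotent χ ψ
      (by rw [mul_smul_comm, ← lowerProj_transpose, ← Matrix.transpose_mul, h2,
        Matrix.transpose_zero, smul_zero])
      (by rw [smul_mul_assoc, ← lowerProj_transpose, ← Matrix.transpose_mul, h1])
  choose s hs1 hs2 hs3 using hs
  have h := hasDerivAt_pushTest f (mulRightL η) (fun _ => (1 : S K).1) (fun t => (s t).1)
    (fun t x => by simp [act, hs2, mul_add])
    (fun t x => by simp [act, hs1, mul_add]; abel) φ
  refine h.congr_of_eventuallyEq (Eventually.of_forall fun t => ?_)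
  have h3 := LinearMap.congr_fun (hf 1 (s t)) φ
  change f (pushTest (1 : S K).1 (s t).1 φ) = _ * f φ at h3
  have h4 : (shift K * η.transpose).trace = ((shift K).transpose * η).trace := by
    rw [← Matrix.trace_transpose, Matrix.transpose_mul, Matrix.transpose_transpose,
      Matrix.trace_mul_comm]
  change _ = f (pushTest (1 : S K).1 (s t).1 φ)
  rw [h3, hs3]
  simp [Matrix.trace_smul, h4]

/-- The infinitesimal form of the equivariance of a nonzero generalized function under the
unipotent radicals of the maximal parabolics. -/
lemma exists_infinitesimal_character (hψ : ψ ≠ 1) (hf : IsEquivariant χ ψ f) (hf0 : f ≠ 0) :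
    ∃ κ : K →ₗ[ℝ] ℝ, κ ≠ 0 ∧
      (∀ (k : ℕ) (ξ : Mat K), lowerProj K k * ξ = 0 → ξ * lowerProj K k = ξ →
        ∀ φ, f (vectorField (mulLeftL ξ) (mulLeftL ξ).contDiff φ) =
          Complex.I * (-κ (shift K * ξ).trace • f φ)) ∧
      (∀ (k : ℕ) (η : Mat K), lowerProj K k * η = η → η * lowerProj K k = 0 →
        ∀ φ, f (vectorField (mulRightL η) (mulRightL η).contDiff φ) =
          Complex.I * (-κ ((shift K).transpose * η).trace • f φ)) := by
  obtain ⟨φ₀, hφ₀⟩ : ∃ φ, f φ ≠ 0 := by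
    by_contra! h
    exact hf0 (by ext φ; simpa using h φ)
  -- Differentiability of `ψ` is read off from `f`: the product `ψ (t z) * f φ₀` is differentiable
  -- in `t`, and `f φ₀ ≠ 0`. The matrix `ξ` below is chosen so that `tr (J ξ) = -z`.
  have hd : ∀ z : K, ∃ d : ℂ, HasDerivAt (fun t : ℝ => (ψ (t • z) : ℂ)) d 0 := by
    intro z
    let ξ : Mat K := Matrix.single 0 2 (-z)
    have h1 : lowerProj K 1 * ξ = 0 := by
      ext i j
      rw [lowerProj_mul_apply, Matrix.zero_apply, ite_eq_right_iff]
      intro hi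
      refine Matrix.single_apply_of_row_ne (i := (0 : Fin 6)) (fun h => ?_) _ _ _
      rw [← h] at hi
      simp at hi
    have h2 : ξ * lowerProj K 1 = ξ := by
      ext i j
      rw [mul_lowerProj_apply, ite_eq_left_iff]
      intro hj
      refine (Matrix.single_apply_of_col_ne (j := (2 : Fin 6)) _ _ (fun h => ?_) _).symm
      rw [← h] at hj
      simp at hj
    have htr : (shift K * ξ).trace = -z := by
      rw [trace_shift_mul]
      rw [Matrix.trace_add, Matrix.trace_fin_two, Matrix.trace_fin_two]
      change ξ 0 2 + ξ 1 3 + (ξ 2 4 + ξ 3 5) = -z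
      simp [ξ]
    have h3 := (hasDerivAt_left hf h1 h2 φ₀).mul_const (f φ₀)⁻¹
    refine ⟨_, h3.congr_of_eventuallyEq (Eventually.of_forall fun t => ?_)⟩
    simp only [htr, neg_neg]
    field_simp
  obtain ⟨κ, hκ0, hκ⟩ := exists_logDeriv_addChar ψ hψ hd
  refine ⟨κ, hκ0, fun k ξ h1 h2 φ => ?_, fun k η h1 h2 φ => ?_⟩
  · rw [(hasDerivAt_left hf h1 h2 φ).unique ((hκ _).mul_const (f φ))]
    simp [mul_assoc]
  · rw [(hasDerivAt_right hf h1 h2 φ).unique ((hκ _).mul_const (f φ))]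
    simp [mul_assoc]

end Infinitesimal

/-! ### Smoothness and derivatives of matrix-valued functions. -/

section MatrixCalculus

variable {K : Type*} [RCLike K] {E : Type*} [NormedAddCommGroup E] [NormedSpace ℝ E]

lemma contDiff_matrix_iff {f : E → Mat K} :
    ContDiff ℝ ∞ f ↔ ∀ i j, ContDiff ℝ ∞ fun x => f x i j :=
  (contDiff_pi (Φ := f)).trans (forall_congr' fun i => contDiff_pi (Φ := fun x => f x i))

lemma contDiff_matrix_mul {f g : E → Mat K} (hf : ContDiff ℝ ∞ f) (hg : ContDiff ℝ ∞ g) :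
    ContDiff ℝ ∞ fun x => f x * g x := by
  rw [contDiff_matrix_iff] at *
  intro i j
  simp only [Matrix.mul_apply]
  exact ContDiff.sum fun k _ => (hf i k).mul (hg k j)

lemma contDiff_matrix_det {n : ℕ} {f : E → Matrix (Fin n) (Fin n) K}
    (hf : ∀ i j, ContDiff ℝ ∞ fun x => f x i j) : ContDiff ℝ ∞ fun x => (f x).det := by
  simp only [Matrix.det_apply']
  exact ContDiff.sum fun σ _ => contDiff_const.mul (contDiff_prod fun i _ => hf _ _)

lemma contDiff_matrix_adjugate {f : E → Mat K} (hf : ContDiff ℝ ∞ f) :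
    ContDiff ℝ ∞ fun x => (f x).adjugate := by
  rw [contDiff_matrix_iff] at *
  intro i j
  simp only [Matrix.adjugate_apply]
  refine contDiff_matrix_det fun r s => ?_
  simp only [Matrix.updateRow_apply]
  split_ifs
  · exact contDiff_const
  · exact hf r s

lemma hasDerivAt_matrix_iff {f : ℝ → Mat K} {f' : Mat K} {t : ℝ} :
    HasDerivAt f f' t ↔ ∀ i j, HasDerivAt (fun t => f t i j) (f' i j) t :=
  (hasDerivAt_pi (φ := f) (φ' := f')).trans
    (forall_congr' fun i => hasDerivAt_pi (φ := fun t => f t i) (φ' := f' i))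

lemma hasDerivAt_matrix_mul {f g : ℝ → Mat K} {f' g' : Mat K} {t : ℝ}
    (hf : HasDerivAt f f' t) (hg : HasDerivAt g g' t) :
    HasDerivAt (fun t => f t * g t) (f' * g t + f t * g') t := by
  rw [hasDerivAt_matrix_iff] at *
  intro i j
  simp only [Matrix.mul_apply, Matrix.add_apply, ← Finset.sum_add_distrib]
  exact HasDerivAt.fun_sum fun k _ => (hf i k).mul (hg k j)

/-- The derivative of the adjugate at the identity, up to a scalar matrix. -/
lemma hasDerivAt_adjugate (N : Mat K) :
    ∃ d : K, HasDerivAt (fun t : ℝ => (1 + t • N).det) d 0 ∧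
      HasDerivAt (fun t : ℝ => (1 + t • N).adjugate) (d • 1 - N) 0 := by
  have hline : ContDiff ℝ ∞ fun t : ℝ => 1 + t • N := contDiff_const.add (contDiff_id.smul contDiff_const)
  have hlined : HasDerivAt (fun t : ℝ => 1 + t • N) N 0 := by
    simpa using ((hasDerivAt_id (0 : ℝ)).smul_const N).const_add 1
  have h1 := ((contDiff_matrix_det (contDiff_matrix_iff.mp hline)).differentiable
    (by simp) 0).hasDerivAt
  have h2 := ((contDiff_matrix_adjugate hline).differentiable (by simp) 0).hasDerivAt
  refine ⟨_, h1, ?_⟩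
  -- Differentiate `M * adj M = det M • 1` at `M = 1`.
  have h3 := hasDerivAt_matrix_mul hlined h2
  simp only [Matrix.mul_adjugate] at h3
  have h4 : HasDerivAt (fun t : ℝ => (1 + t • N).det • (1 : Mat K))
      (deriv (fun t : ℝ => (1 + t • N).det) 0 • 1) 0 :=
    hasDerivAt_matrix_iff.mpr fun i j => h1.mul_const ((1 : Mat K) i j)
  have h5 := h3.unique h4
  rw [zero_smul, add_zero, Matrix.adjugate_one, mul_one, one_mul] at h5
  rw [← h5, add_sub_cancel_left]
  exact h2

end MatrixCalculus

/-! ### Generalized inverses and deformation of kernels. -/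

section GeneralizedInverse

variable {n F : Type*} [Fintype n] [DecidableEq n] [Field F]

/-- Choose a linear section of `D` over its range and extend it to the whole space. -/
lemma exists_generalizedInverse (D : Matrix n n F) : ∃ G, D * G * D = D := by
  obtain ⟨h, hh⟩ := LinearMap.exists_rightInverse_of_surjective (Matrix.toLin' D).rangeRestrict
    (LinearMap.range_rangeRestrict _)
  obtain ⟨g, hg⟩ := LinearMap.exists_extend h
  refine ⟨LinearMap.toMatrix' g, ?_⟩
  apply Matrix.toLin'.injective
  rw [Matrix.toLin'_mul, Matrix.toLin'_mul, Matrix.toLin'_toMatrix']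
  ext1 v
  refine LinearMap.ext fun c => ?_
  have h1 : g (Matrix.toLin' D (LinearMap.single F (fun _ => F) v c)) =
      h ((Matrix.toLin' D).rangeRestrict (LinearMap.single F (fun _ => F) v c)) :=
    LinearMap.congr_fun hg ((Matrix.toLin' D).rangeRestrict (LinearMap.single F (fun _ => F) v c))
  have h2 := congrArg Subtype.val
    (LinearMap.congr_fun hh ((Matrix.toLin' D).rangeRestrict (LinearMap.single F (fun _ => F) v c)))
  simp only [LinearMap.comp_apply] at h2 ⊢
  rw [h1]
  exact h2

/-- If `rank D ≤ rank D₀`, the kernel of `D` contains the deformation of the kernel of `D₀`. -/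
lemma mul_adjugate_eq_zero {D D₀ G Θ : Matrix n n F} (h1 : D₀ * G * D₀ = D₀) (h2 : G * D₀ * G = G)
    (hΘ : D₀ * Θ = 0) (hrank : D.rank ≤ D₀.rank) (hM : (1 + G * (D - D₀)).det ≠ 0) :
    D * ((1 + G * (D - D₀)).adjugate * Θ) = 0 := by
  set M := 1 + G * (D - D₀) with hMdef
  -- This factorization shows that `M⁻¹` carries `ker D₀` into `ker (G D)`. When `M` is invertible
  -- it also gives `rank (G D) ≥ rank D₀ ≥ rank D`, so `ker (G D) = ker D`. The adjugate replaces
  -- `M⁻¹` in order to stay polynomial.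
  have hGD : G * D = G * D₀ * M := by
    rw [hMdef, mul_add, mul_one, ← mul_assoc, h2, mul_sub]
    abel
  have h3 : G * D * (M.adjugate * Θ) = 0 := by
    rw [hGD, mul_assoc, ← mul_assoc M, Matrix.mul_adjugate, Matrix.smul_mul, one_mul,
      Matrix.mul_smul, mul_assoc, hΘ, mul_zero, smul_zero]
  have h4 : D.rank ≤ (G * D).rank := by
    rw [hGD, Matrix.rank_mul_eq_left_of_isUnit_det _ _ (isUnit_iff_ne_zero.mpr hM)]
    refine hrank.trans ?_
    conv_lhs => rw [← h1, mul_assoc]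
    exact Matrix.rank_mul_le_right _ _
  have hker : LinearMap.ker D.mulVecLin = LinearMap.ker (G * D).mulVecLin := by
    apply Submodule.eq_of_le_of_finrank_le
    · intro v hv
      rw [LinearMap.mem_ker, Matrix.mulVecLin_apply] at hv ⊢
      rw [← Matrix.mulVec_mulVec, hv, Matrix.mulVec_zero]
    · have e1 := D.mulVecLin.finrank_range_add_finrank_ker
      have e2 := (G * D).mulVecLin.finrank_range_add_finrank_ker
      change D.rank + _ = _ at e1
      change (G * D).rank + _ = _ at e2
      omega
  ext i j
  have h5 : (M.adjugate * Θ).col j ∈ LinearMap.ker (G * D).mulVecLin := by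
    rw [LinearMap.mem_ker, Matrix.mulVecLin_apply]
    ext r
    exact congrFun (congrFun h3 r) j
  rw [← hker, LinearMap.mem_ker, Matrix.mulVecLin_apply] at h5
  exact congrFun h5 i

lemma adjugate_mul_eq_zero {D D₀ G Θ : Matrix n n F} (h1 : D₀ * G * D₀ = D₀) (h2 : G * D₀ * G = G)
    (hΘ : Θ * D₀ = 0) (hrank : D.rank ≤ D₀.rank) (hM : (1 + (D - D₀) * G).det ≠ 0) :
    Θ * (1 + (D - D₀) * G).adjugate * D = 0 := by
  have e : (1 + (D - D₀) * G).transpose = 1 + G.transpose * (D.transpose - D₀.transpose) := by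
    simp
  have h := mul_adjugate_eq_zero (D := D.transpose) (D₀ := D₀.transpose) (G := G.transpose)
    (Θ := Θ.transpose) (by simp only [← Matrix.transpose_mul, ← mul_assoc, h1])
    (by simp only [← Matrix.transpose_mul, ← mul_assoc, h2])
    (by simp only [← Matrix.transpose_mul, hΘ, Matrix.transpose_zero])
    (by simpa only [Matrix.rank_transpose] using hrank)
    (by rwa [← e, Matrix.det_transpose])
  rw [← e, ← Matrix.adjugate_transpose] at h
  simpa only [← Matrix.transpose_mul, Matrix.transpose_eq_zero] using h

/-- From `(1 + Y) adj (1 + Y) Θ = det (1 + Y) Θ`, the matrix `adj (1 + Y) Θ` is a multiple of `Θ`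
minus `Y` times something, and `P` fixes both. -/
lemma mul_adjugate_mul_eq {P Y Θ : Matrix n n F} (h : P * Θ = Θ) (hY : P * Y = Y) :
    P * ((1 + Y).adjugate * Θ) = (1 + Y).adjugate * Θ := by
  have h1 : (1 + Y) * ((1 + Y).adjugate * Θ) = (1 + Y).det • Θ := by
    rw [← mul_assoc, Matrix.mul_adjugate, Matrix.smul_mul, one_mul]
  rw [add_mul, one_mul, ← eq_sub_iff_add_eq] at h1
  rw [h1, mul_sub, Matrix.mul_smul, h, ← mul_assoc, hY]

lemma adjugate_mul_mul_eq {P Y Θ : Matrix n n F} (h : Θ * P = Θ) (hY : Y * P = Y) :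
    Θ * (1 + Y).adjugate * P = Θ * (1 + Y).adjugate := by
  have h1 : Θ * (1 + Y).adjugate * (1 + Y) = (1 + Y).det • Θ := by
    rw [mul_assoc, Matrix.adjugate_mul, Matrix.mul_smul, mul_one]
  rw [mul_add, mul_one, ← eq_sub_iff_add_eq] at h1
  rw [h1, sub_mul, Matrix.smul_mul, h, mul_assoc, hY]

end GeneralizedInverse

/-! ### Smooth families of kernel matrices of a corner. -/

section KernelFamily

variable {K : Type*} [RCLike K]

lemma exists_reflexive_inverse {n F : Type*} [Fintype n] [DecidableEq n] [Field F]
    {D P R : Matrix n n F} (hPP : P * P = P) (hRR : R * R = R) (hP : P * D = D)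
    (hR : D * R = D) :
    ∃ G, R * G = G ∧ G * P = G ∧ D * G * D = D ∧ G * D * G = G := by
  obtain ⟨H, hH⟩ := exists_generalizedInverse D
  have hH' (z : Matrix n n F) : D * (H * (D * z)) = D * z := by
    rw [← mul_assoc, ← mul_assoc, hH]
  have hRR' (z : Matrix n n F) : R * (R * z) = R * z := by rw [← mul_assoc, hRR]
  rw [mul_assoc] at hH
  have hR' (z : Matrix n n F) : D * (R * z) = D * z := by rw [← mul_assoc, hR]
  -- Passing from `H` to `H D H` makes the inverse reflexive, and the projections fit it to the
  -- corner.
  refine ⟨R * (H * D * H) * P, ?_, ?_, ?_, ?_⟩ <;>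
    simp only [mul_assoc, hPP, hRR', hP, hR', hH, hH']

/-- The lower right corner of a matrix, extended by zero. -/
def corner (k l : ℕ) (x : Mat K) : Mat K := lowerProj K k * x * lowerProj K l

lemma corner_corner (k l : ℕ) (x : Mat K) : corner k l (corner k l x) = corner k l x := by
  simp only [corner, mul_assoc, lowerProj_mul_self]
  simp only [← mul_assoc, lowerProj_mul_self]

lemma corner_add (k l : ℕ) (x y : Mat K) : corner k l (x + y) = corner k l x + corner k l y := by
  simp only [corner, mul_add, add_mul]

lemma corner_smul (k l : ℕ) (t : ℝ) (x : Mat K) : corner k l (t • x) = t • corner k l x := by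
  simp only [corner, Matrix.mul_smul, Matrix.smul_mul]

lemma contDiff_corner (k l : ℕ) : ContDiff ℝ ∞ (corner k l : Mat K → Mat K) :=
  contDiff_matrix_mul (contDiff_matrix_mul contDiff_const contDiff_id) contDiff_const

/-- `Θ` is a matrix in the left and right kernel of the corner of `x`. -/
structure IsKernelMatrix (k l : ℕ) (x Θ : Mat K) : Prop where
  left : lowerProj K l * Θ = Θ
  right : Θ * lowerProj K k = Θ
  mul_left : lowerProj K k * x * Θ = 0
  mul_right : Θ * x * lowerProj K l = 0

/-- A matrix in the left and right kernel of the corner of `x₀` extends to a smooth family of such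
matrices over the locus where the rank of the corner does not exceed that of `x₀`. -/
structure KernelFamily (k l : ℕ) (x₀ Θ₀ : Mat K) where
  toFun : Mat K → Mat K
  contDiff : ContDiff ℝ ∞ toFun
  apply_base : toFun x₀ = Θ₀
  apply_corner : ∀ x, toFun (corner k l x) = toFun x
  left : ∀ x, lowerProj K l * toFun x = toFun x
  right : ∀ x, toFun x * lowerProj K k = toFun x
  isKernelMatrix : ∀ x, (corner k l x).rank ≤ (corner k l x₀).rank → IsKernelMatrix k l x (toFun x)
  inv : Mat K
  inv_mul : inv * x₀ * Θ₀ = 0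
  mul_inv : Θ₀ * x₀ * inv = 0
  hasDerivAt : ∀ X, ∃ s : K, HasDerivAt (fun t : ℝ => toFun (x₀ + t • X))
    (s • Θ₀ - inv * X * Θ₀ - Θ₀ * X * inv) 0

lemma nonempty_kernelFamily {k l : ℕ} {x₀ Θ₀ : Mat K} (h : IsKernelMatrix k l x₀ Θ₀) :
    Nonempty (KernelFamily k l x₀ Θ₀) := by
  set π := lowerProj K k with hπ
  set ρ := lowerProj K l with hρ
  have hππ : π * π = π := lowerProj_mul_self k
  have hρρ : ρ * ρ = ρ := lowerProj_mul_self l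
  obtain ⟨h1, h2, h3, h4⟩ := h
  set D₀ := corner k l x₀ with hD₀
  have hπD (x : Mat K) : π * corner k l x = corner k l x := by
    simp only [corner, ← mul_assoc, hππ, ← hπ]
  have hDρ (x : Mat K) : corner k l x * ρ = corner k l x := by
    simp only [corner, mul_assoc, hρρ, ← hρ]
  obtain ⟨G, hρG, hGπ, hDGD, hGDG⟩ := exists_reflexive_inverse hππ hρρ (hπD x₀) (hDρ x₀)
  rw [← hD₀] at hDGD hGDG
  have hDΘ : D₀ * Θ₀ = 0 := by rw [hD₀, corner, mul_assoc, ← hρ, h1, h3]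
  have hΘD : Θ₀ * D₀ = 0 := by rw [hD₀, corner, ← mul_assoc, ← mul_assoc, ← hπ, h2, h4]
  let Mx : Mat K → Mat K := fun x => 1 + G * (corner k l x - D₀)
  let Nx : Mat K → Mat K := fun x => 1 + (corner k l x - D₀) * G
  have hdet (x : Mat K) : (Mx x).det = (Nx x).det := Matrix.det_one_add_mul_comm _ _
  -- Up to a scalar this is `M⁻¹ Θ₀ N⁻¹`: the left factor deforms the right kernel, the right factor
  -- the left kernel. The extra determinant makes `T` vanish where `M`, or equivalently `N`, is
  -- singular, so the kernel property holds wherever the rank bound does, not just near `x₀`.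
  let T : Mat K → Mat K := fun x => (Mx x).det • ((Mx x).adjugate * Θ₀ * (Nx x).adjugate)
  have hM : ContDiff ℝ ∞ Mx :=
    contDiff_const.add (contDiff_matrix_mul contDiff_const ((contDiff_corner k l).sub contDiff_const))
  have hN : ContDiff ℝ ∞ Nx :=
    contDiff_const.add (contDiff_matrix_mul ((contDiff_corner k l).sub contDiff_const) contDiff_const)
  have hT : ContDiff ℝ ∞ T := by
    rw [contDiff_matrix_iff]
    intro i j
    exact (contDiff_matrix_det (contDiff_matrix_iff.mp hM)).mul (contDiff_matrix_iff.mp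
      (contDiff_matrix_mul (contDiff_matrix_mul (contDiff_matrix_adjugate hM) contDiff_const)
        (contDiff_matrix_adjugate hN)) i j)
  have hleft (x : Mat K) : ρ * T x = T x := by
    have e : ρ * (G * (corner k l x - D₀)) = G * (corner k l x - D₀) := by
      rw [← mul_assoc, hρG]
    simp only [T, Mx, Matrix.mul_smul, ← mul_assoc ρ]
    rw [mul_assoc ρ, mul_adjugate_mul_eq h1 e]
  have hright (x : Mat K) : T x * π = T x := by
    have e : (corner k l x - D₀) * G * π = (corner k l x - D₀) * G := by
      rw [mul_assoc, hGπ]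
    simp only [T, Nx, Matrix.smul_mul, mul_assoc]
    rw [← mul_assoc Θ₀, adjugate_mul_mul_eq h2 e]
  refine ⟨⟨T, hT, ?_, ?_, hleft, hright, ?_, G, ?_, ?_, ?_⟩⟩
  · simp [T, Mx, Nx, ← hD₀]
  · intro x
    simp only [T, Mx, Nx, corner_corner]
  · intro x hx
    refine ⟨hleft x, hright x, ?_, ?_⟩
    · have : π * x * T x = corner k l x * T x := by
        rw [corner, ← hπ, ← hρ, mul_assoc _ ρ, hleft]
      rw [this]
      by_cases h0 : (Mx x).det = 0
      · simp only [T, h0, zero_smul, mul_zero]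
      · simp only [T, Matrix.mul_smul]
        rw [← mul_assoc, mul_adjugate_eq_zero hDGD hGDG hDΘ hx h0, zero_mul, smul_zero]
    · have : T x * x * ρ = T x * corner k l x := by
        rw [corner, ← mul_assoc, ← mul_assoc, ← hπ, hright]
      rw [this]
      by_cases h0 : (Mx x).det = 0
      · simp only [T, h0, zero_smul, zero_mul]
      · simp only [T, Matrix.smul_mul]
        rw [mul_assoc _ Θ₀, mul_assoc, adjugate_mul_eq_zero hDGD hGDG hΘD hx (by rwa [← hdet]),
          mul_zero, smul_zero]
  · rw [← hGπ, mul_assoc, mul_assoc, ← mul_assoc π, h3, mul_zero]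
  · rw [← hρG, ← mul_assoc, h4, zero_mul]
  · intro X
    obtain ⟨d, hd, hd'⟩ := hasDerivAt_adjugate (G * corner k l X)
    obtain ⟨e, -, he'⟩ := hasDerivAt_adjugate (corner k l X * G)
    have eM (t : ℝ) : Mx (x₀ + t • X) = 1 + t • (G * corner k l X) := by
      simp only [Mx, corner_add, corner_smul, ← hD₀, add_sub_cancel_left, Matrix.mul_smul]
    have eN (t : ℝ) : Nx (x₀ + t • X) = 1 + t • (corner k l X * G) := by
      simp only [Nx, corner_add, corner_smul, ← hD₀, add_sub_cancel_left, Matrix.smul_mul]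
    have hprod := hasDerivAt_matrix_mul (hasDerivAt_matrix_mul hd' (hasDerivAt_const (0 : ℝ) Θ₀)) he'
    refine ⟨d + d + e, ?_⟩
    have hfun : (fun t : ℝ => T (x₀ + t • X)) = fun t : ℝ => (1 + t • (G * corner k l X)).det •
        ((1 + t • (G * corner k l X)).adjugate * Θ₀ * (1 + t • (corner k l X * G)).adjugate) := by
      funext t
      simp only [T, eM, eN]
    rw [hfun]
    have e1 : G * corner k l X * Θ₀ = G * X * Θ₀ := by
      rw [corner, ← hπ, ← hρ, mul_assoc, mul_assoc _ ρ, h1, ← mul_assoc, ← mul_assoc, hGπ]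
    have e2 : Θ₀ * (corner k l X * G) = Θ₀ * X * G := by
      rw [corner, ← hπ, ← hρ, mul_assoc _ ρ, hρG, ← mul_assoc, ← mul_assoc, hπ, h2]
    have e3 : (d • 1 - G * corner k l X) * Θ₀ = d • Θ₀ - G * X * Θ₀ := by
      rw [sub_mul, Matrix.smul_mul, one_mul, e1]
    have e4 : Θ₀ * (e • 1 - corner k l X * G) = e • Θ₀ - Θ₀ * X * G := by
      rw [mul_sub, Matrix.mul_smul, mul_one, e2]
    refine hasDerivAt_matrix_iff.mpr fun i j => ?_
    refine (hd.mul (hasDerivAt_matrix_iff.mp hprod i j)).congr_deriv ?_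
    simp only [zero_smul, add_zero, Matrix.det_one, Matrix.adjugate_one, mul_one, one_mul, mul_zero,
      e3, e4]
    simp only [Matrix.sub_apply, Matrix.add_apply, Matrix.smul_apply, smul_eq_mul]
    ring

end KernelFamily

/-! ### Functions of the corner, and the vector field `x Θ(x) x` evaluated in two ways. -/

section CornerFunctions

variable {K : Type*} [RCLike K]

lemma fderiv_apply_eq_of_line {q : Mat K → ℝ} {x X : Mat K} {b : ℝ} (hq : DifferentiableAt ℝ q x)
    (h : HasDerivAt (fun t : ℝ => q (x + t • X)) b 0) : fderiv ℝ q x X = b :=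
  (hq.hasFDerivAt.hasLineDerivAt X).unique h

lemma fderiv_apply_eq_of_affine {q : Mat K → ℝ} {x X : Mat K} {b : ℝ} (hq : DifferentiableAt ℝ q x)
    (h : ∀ t : ℝ, q (x + t • X) = q x + t * b) : fderiv ℝ q x X = b := by
  refine fderiv_apply_eq_of_line hq ?_
  simp only [h]
  simpa using ((hasDerivAt_id (0 : ℝ)).mul_const b).const_add (q x)

/-- The function `x ↦ L (Y x)` for a linear form `L`. -/
def linearCoord (L : Mat K →ₗ[ℝ] ℝ) (Y : Mat K → Mat K) (hY : ContDiff ℝ ∞ Y) :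
    smoothFunctions (Mat K) :=
  ⟨fun x => L (Y x), (LinearMap.toContinuousLinearMap L).contDiff.comp hY⟩

lemma linearCoord_apply (L : Mat K →ₗ[ℝ] ℝ) (Y : Mat K → Mat K) (hY : ContDiff ℝ ∞ Y) (x : Mat K) :
    (linearCoord L Y hY).1 x = L (Y x) := rfl

/-- The linear form `ξ ↦ κ (tr (N ξ))`. -/
def characterForm (κ : K →ₗ[ℝ] ℝ) (N : Mat K) : Mat K →ₗ[ℝ] ℝ :=
  κ ∘ₗ Matrix.traceLinearMap (Fin 6) ℝ K ∘ₗ LinearMap.mulLeft ℝ N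

lemma characterForm_apply (κ : K →ₗ[ℝ] ℝ) (N ξ : Mat K) :
    characterForm κ N ξ = κ (N * ξ).trace := rfl

/-- The smooth functions which only depend on the lower right corner. -/
def cornerFunctions (K : Type*) [RCLike K] (k l : ℕ) : Submonoid (smoothFunctions (Mat K)) where
  carrier := {q | ∀ x, q.1 (corner k l x) = q.1 x}
  one_mem' _ := rfl
  mul_mem' {p q} hp hq x := by
    change p.1 _ * q.1 _ = p.1 x * q.1 x
    rw [hp x, hq x]

lemma fderiv_eq_zero_of_mem_cornerFunctions {k l : ℕ} {q : smoothFunctions (Mat K)}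
    (hq : q ∈ cornerFunctions K k l) {x X : Mat K} (hX : corner k l X = 0) :
    fderiv ℝ q.1 x X = 0 := by
  refine fderiv_apply_eq_of_affine (differentiableAt_smooth q x) fun t => ?_
  rw [mul_zero, add_zero, ← hq (x + t • X), ← hq x, corner_add, corner_smul, hX, smul_zero, add_zero]

/-- Infinitesimal equivariance under the unipotent radical of a maximal parabolic acting from the
left. -/
def IsLeftEigen (κ : K →ₗ[ℝ] ℝ) (k : ℕ) (F : 𝓓(GLOpen K, ℝ) →ₗ[ℝ] ℂ) : Prop :=
  ∀ ξ : Mat K, lowerProj K k * ξ = 0 → ξ * lowerProj K k = ξ → ∀ φ,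
    F (vectorField (mulLeftL ξ) (mulLeftL ξ).contDiff φ) =
      Complex.I * (-characterForm κ (shift K) ξ • F φ)

/-- Infinitesimal equivariance under the opposite unipotent radical of a maximal parabolic acting
from the right. -/
def IsRightEigen (κ : K →ₗ[ℝ] ℝ) (l : ℕ) (F : 𝓓(GLOpen K, ℝ) →ₗ[ℝ] ℂ) : Prop :=
  ∀ η : Mat K, lowerProj K l * η = η → η * lowerProj K l = 0 → ∀ φ,
    F (vectorField (mulRightL η) (mulRightL η).contDiff φ) =
      Complex.I * (-characterForm κ (shift K).transpose η • F φ)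

variable {κ : K →ₗ[ℝ] ℝ} {k l : ℕ} {F : 𝓓(GLOpen K, ℝ) →ₗ[ℝ] ℂ}

lemma vectorField_mulSmooth_of_corner {q : smoothFunctions (Mat K)}
    (hq : q ∈ cornerFunctions K k l) (V : Mat K →L[ℝ] Mat K) (hV : ∀ x, corner k l (V x) = 0)
    (φ : 𝓓(GLOpen K, ℝ)) :
    vectorField V V.contDiff (mulSmooth q φ) = mulSmooth q (vectorField V V.contDiff φ) := by
  rw [vectorField_mulSmooth]
  have : derivAlong V V.contDiff q = 0 := by
    ext x
    exact fderiv_eq_zero_of_mem_cornerFunctions hq (hV x)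
  rw [this, map_zero, LinearMap.zero_apply, zero_add]

/-- The field `ξ x` has zero corner, so it differentiates `q` to zero and commutes with
multiplication by `q`. -/
lemma IsLeftEigen.comp_mulSmooth (h : IsLeftEigen κ k F) {q : smoothFunctions (Mat K)}
    (hq : q ∈ cornerFunctions K k l) : IsLeftEigen κ k (F ∘ₗ mulSmooth q) := by
  intro ξ h1 h2 φ
  have hV (x : Mat K) : corner k l (mulLeftL ξ x) = 0 := by
    rw [corner, mulLeftL_apply, ← mul_assoc, h1, zero_mul, zero_mul]
  rw [LinearMap.comp_apply, ← vectorField_mulSmooth_of_corner hq _ hV]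
  exact h ξ h1 h2 _

lemma IsRightEigen.comp_mulSmooth (h : IsRightEigen κ l F) {q : smoothFunctions (Mat K)}
    (hq : q ∈ cornerFunctions K k l) : IsRightEigen κ l (F ∘ₗ mulSmooth q) := by
  intro η h1 h2 φ
  have hV (x : Mat K) : corner k l (mulRightL η x) = 0 := by
    rw [corner, mulRightL_apply, mul_assoc, mul_assoc, h2, mul_zero, mul_zero]
  rw [LinearMap.comp_apply, ← vectorField_mulSmooth_of_corner hq _ hV]
  exact h η h1 h2 _

lemma sum_coord_smul_apply {ι V W : Type*} [Fintype ι] [AddCommGroup V] [Module ℝ V]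
    [AddCommGroup W] [Module ℝ W] (b : Module.Basis ι ℝ V) (A : V →ₗ[ℝ] W) (Y : V) :
    ∑ i, b.coord i Y • A (b i) = A Y := by
  conv_rhs => rw [← b.sum_repr Y]
  simp only [map_sum, map_smul, Module.Basis.coord_apply]

variable {x₀ Θ₀ : Mat K} (Θ : KernelFamily k l x₀ Θ₀) {C : Set (Mat K)}

lemma KernelFamily.contDiff_left : ContDiff ℝ ∞ fun x => lowerProj K k * x * Θ.toFun x :=
  contDiff_matrix_mul (contDiff_matrix_mul contDiff_const contDiff_id) Θ.contDiff

lemma KernelFamily.contDiff_right : ContDiff ℝ ∞ fun x => Θ.toFun x * x * lowerProj K l :=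
  contDiff_matrix_mul (contDiff_matrix_mul Θ.contDiff contDiff_id) contDiff_const

lemma KernelFamily.contDiff_sandwich : ContDiff ℝ ∞ fun x => x * Θ.toFun x * x :=
  contDiff_matrix_mul (contDiff_matrix_mul contDiff_id Θ.contDiff) contDiff_id

lemma KernelFamily.contDiff_mul_left : ContDiff ℝ ∞ fun x => x * Θ.toFun x :=
  contDiff_matrix_mul contDiff_id Θ.contDiff

lemma KernelFamily.contDiff_mul_right : ContDiff ℝ ∞ fun x => Θ.toFun x * x :=
  contDiff_matrix_mul Θ.contDiff contDiff_id

lemma KernelFamily.left_mem_cornerFunctions (L : Mat K →ₗ[ℝ] ℝ) :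
    linearCoord L _ Θ.contDiff_left ∈ cornerFunctions K k l := by
  intro x
  simp only [linearCoord_apply]
  congr 1
  rw [Θ.apply_corner, ← Θ.left x, ← mul_assoc, ← mul_assoc]
  change corner k l (corner k l x) * _ = corner k l x * _
  rw [corner_corner]

lemma KernelFamily.right_mem_cornerFunctions (L : Mat K →ₗ[ℝ] ℝ) :
    linearCoord L _ Θ.contDiff_right ∈ cornerFunctions K k l := by
  intro x
  simp only [linearCoord_apply]
  congr 1
  rw [Θ.apply_corner, ← Θ.right x]
  simp only [mul_assoc]
  congr 1
  simp only [← mul_assoc]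
  exact corner_corner k l x

lemma KernelFamily.apply_add_of_corner (x X : Mat K) (t : ℝ) (hX : corner k l X = 0) :
    Θ.toFun (x + t • X) = Θ.toFun x := by
  rw [← Θ.apply_corner, corner_add, corner_smul, hX, smul_zero, add_zero, Θ.apply_corner]

/-- Write `x Θ x` as `(x Θ - π x Θ) x + (π x Θ) x`. The first factor lies in the unipotent Lie
algebra, where `F` is an eigenvector. The coordinates of `π x Θ` annihilate `F`. -/
lemma KernelFamily.apply_sandwich_left (hF : IsLeftEigen κ k F)
    (hh : ∀ j, Annihilates C
      (linearCoord ((Module.finBasis ℝ (Mat K)).coord j) _ Θ.contDiff_left) F)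
    (φ : 𝓓(GLOpen K, ℝ)) (hφ : tsupport φ ⊆ C) :
    F (vectorField _ Θ.contDiff_sandwich φ) =
      Complex.I * F (mulSmooth (linearCoord (-characterForm κ (shift K)) _
        (Θ.contDiff_mul_left.sub Θ.contDiff_left)) φ) := by
  set b := Module.finBasis ℝ (Mat K)
  set π := lowerProj K k with hπ
  have hππ : π * π = π := lowerProj_mul_self k
  let A : Mat K →ₗ[ℝ] Mat K := LinearMap.mulLeft ℝ (1 - π) ∘ₗ LinearMap.mulRight ℝ π
  have hA (y : Mat K) : A y = (1 - π) * (y * π) := rfl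
  have h1 (y : Mat K) : π * A y = 0 := by
    rw [hA, ← mul_assoc, mul_sub, mul_one, hππ, sub_self, zero_mul]
  have h2 (y : Mat K) : A y * π = A y := by simp only [hA, mul_assoc, hππ]
  have hcorner (y x : Mat K) : corner k l (A y * x) = 0 := by
    rw [corner, ← mul_assoc, ← hπ, h1, zero_mul, zero_mul]
  have hAΘ (x : Mat K) : A (x * Θ.toFun x) = x * Θ.toFun x - π * x * Θ.toFun x := by
    rw [hA, mul_assoc x, Θ.right, sub_mul, one_mul, mul_assoc π]
  -- Moving along `A (b i) x` leaves `Θ` fixed, so the divergence is `∑ i, b.coord i ((1 - π) (b i)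
  -- π x Θ)`. This is linear in the annihilating matrix `π x Θ`, and `a` lists its coefficients.
  let a : _ → ℝ := fun j => ∑ i, b.coord i ((1 - π) * (b i * b j))
  rw [apply_vectorField_combination (F := F) (C := C) (fun i => mulLeftL (A (b i)))
    (fun i => (mulLeftL (A (b i))).contDiff) (fun i => -characterForm κ (shift K) (A (b i)))
    (fun i φ => hF _ (h1 _) (h2 _) φ)
    (fun i => linearCoord (b.coord i) _ Θ.contDiff_mul_left)
    (fun j => mulLeftL (b j)) (fun j => (mulLeftL (b j)).contDiff)
    (fun j => linearCoord (b.coord j) _ Θ.contDiff_left) hh _ Θ.contDiff_sandwich ?_ a ?_ φ hφ]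
  · refine congrArg (fun q => Complex.I * F (mulSmooth q φ)) (Subtype.ext (funext fun x => ?_))
    have := sum_coord_smul_apply b (characterForm κ (shift K) ∘ₗ A) (x * Θ.toFun x)
    simp only [LinearMap.comp_apply, hAΘ] at this
    simp only [linearCoord_apply, LinearMap.neg_apply, ← hπ, ← this]
    rw [AddSubmonoidClass.coe_finsetSum, Finset.sum_apply, ← Finset.sum_neg_distrib]
    refine Finset.sum_congr rfl fun i _ => ?_
    change -_ * b.coord i _ = -(b.coord i _ * _)
    ring
  · intro x
    have e1 := sum_coord_smul_apply b (LinearMap.mulRight ℝ x ∘ₗ A) (x * Θ.toFun x)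
    have e2 := sum_coord_smul_apply b (LinearMap.mulRight ℝ x) (π * x * Θ.toFun x)
    change ∑ i, b.coord i _ • (A (b i) * x) = A _ * x at e1
    change ∑ i, b.coord i _ • (b i * x) = _ * x at e2
    simp only [linearCoord_apply, mulLeftL_apply, ← hπ, e1, e2, hAΘ]
    rw [sub_mul, sub_add_cancel]
  · intro x
    let B : Mat K →ₗ[ℝ] ℝ := ∑ i, b.coord i ∘ₗ LinearMap.mulLeft ℝ (1 - π) ∘ₗ LinearMap.mulLeft ℝ (b i)
    have hB (y : Mat K) : B y = ∑ i, b.coord i ((1 - π) * (b i * y)) := by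
      simp [B, LinearMap.sum_apply]
    have e := sum_coord_smul_apply b B (π * x * Θ.toFun x)
    simp only [hB, smul_eq_mul] at e
    have e' : ∑ j, a j * (linearCoord (b.coord j) _ Θ.contDiff_left).1 x =
        ∑ i, b.coord i ((1 - π) * (b i * (π * x * Θ.toFun x))) := by
      rw [← e]
      exact Finset.sum_congr rfl fun j _ => mul_comm _ _
    rw [e']
    refine Finset.sum_congr rfl fun i _ =>
      fderiv_apply_eq_of_affine (differentiableAt_smooth _ x) fun t => ?_
    simp only [linearCoord_apply, mulLeftL_apply]
    rw [Θ.apply_add_of_corner _ _ _ (hcorner _ _), add_mul, map_add, Matrix.smul_mul, map_smul,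
      smul_eq_mul, hA]
    simp only [mul_assoc]

/-- Mirror image of `KernelFamily.apply_sandwich_left`, with the factorization `x (Θ x)` and the
annihilating matrix `Θ x ρ`. -/
lemma KernelFamily.apply_sandwich_right (hF : IsRightEigen κ l F)
    (hh : ∀ j, Annihilates C
      (linearCoord ((Module.finBasis ℝ (Mat K)).coord j) _ Θ.contDiff_right) F)
    (φ : 𝓓(GLOpen K, ℝ)) (hφ : tsupport φ ⊆ C) :
    F (vectorField _ Θ.contDiff_sandwich φ) =
      Complex.I * F (mulSmooth (linearCoord (-characterForm κ (shift K).transpose) _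
        (Θ.contDiff_mul_right.sub Θ.contDiff_right)) φ) := by
  set b := Module.finBasis ℝ (Mat K)
  set ρ := lowerProj K l with hρ
  have hρρ : ρ * ρ = ρ := lowerProj_mul_self l
  let A : Mat K →ₗ[ℝ] Mat K := LinearMap.mulLeft ℝ ρ ∘ₗ LinearMap.mulRight ℝ (1 - ρ)
  have hA (y : Mat K) : A y = ρ * (y * (1 - ρ)) := rfl
  have h1 (y : Mat K) : ρ * A y = A y := by simp only [hA, ← mul_assoc, hρρ]
  have h2 (y : Mat K) : A y * ρ = 0 := by
    rw [hA, mul_assoc, mul_assoc, sub_mul, one_mul, hρρ, sub_self, mul_zero, mul_zero]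
  have hcorner (y x : Mat K) : corner k l (x * A y) = 0 := by
    rw [corner, mul_assoc, mul_assoc, ← hρ, h2, mul_zero, mul_zero]
  have hAΘ (x : Mat K) : A (Θ.toFun x * x) = Θ.toFun x * x - Θ.toFun x * x * ρ := by
    rw [hA, ← mul_assoc, ← mul_assoc, Θ.left, mul_sub, mul_one]
  let a : _ → ℝ := fun j => ∑ i, b.coord i (b j * b i * (1 - ρ))
  rw [apply_vectorField_combination (F := F) (C := C) (fun i => mulRightL (A (b i)))
    (fun i => (mulRightL (A (b i))).contDiff)
    (fun i => -characterForm κ (shift K).transpose (A (b i)))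
    (fun i φ => hF _ (h1 _) (h2 _) φ)
    (fun i => linearCoord (b.coord i) _ Θ.contDiff_mul_right)
    (fun j => mulRightL (b j)) (fun j => (mulRightL (b j)).contDiff)
    (fun j => linearCoord (b.coord j) _ Θ.contDiff_right) hh _ Θ.contDiff_sandwich ?_ a ?_ φ hφ]
  · refine congrArg (fun q => Complex.I * F (mulSmooth q φ)) (Subtype.ext (funext fun x => ?_))
    have := sum_coord_smul_apply b (characterForm κ (shift K).transpose ∘ₗ A) (Θ.toFun x * x)
    simp only [LinearMap.comp_apply, hAΘ] at this
    simp only [linearCoord_apply, LinearMap.neg_apply, ← hρ, ← this]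
    rw [AddSubmonoidClass.coe_finsetSum, Finset.sum_apply, ← Finset.sum_neg_distrib]
    refine Finset.sum_congr rfl fun i _ => ?_
    change -_ * b.coord i _ = -(b.coord i _ * _)
    ring
  · intro x
    have e1 := sum_coord_smul_apply b (LinearMap.mulLeft ℝ x ∘ₗ A) (Θ.toFun x * x)
    have e2 := sum_coord_smul_apply b (LinearMap.mulLeft ℝ x) (Θ.toFun x * x * ρ)
    change ∑ i, b.coord i _ • (x * A (b i)) = x * A _ at e1
    change ∑ i, b.coord i _ • (x * b i) = x * _ at e2
    simp only [linearCoord_apply, mulRightL_apply, ← hρ, e1, e2, hAΘ]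
    rw [← mul_add, sub_add_cancel, mul_assoc]
  · intro x
    let B : Mat K →ₗ[ℝ] ℝ :=
      ∑ i, b.coord i ∘ₗ LinearMap.mulRight ℝ (1 - ρ) ∘ₗ LinearMap.mulRight ℝ (b i)
    have hB (y : Mat K) : B y = ∑ i, b.coord i (y * b i * (1 - ρ)) := by
      simp [B, LinearMap.sum_apply]
    have e := sum_coord_smul_apply b B (Θ.toFun x * x * ρ)
    simp only [hB, smul_eq_mul] at e
    have e' : ∑ j, a j * (linearCoord (b.coord j) _ Θ.contDiff_right).1 x =
        ∑ i, b.coord i (Θ.toFun x * x * ρ * b i * (1 - ρ)) := by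
      rw [← e]
      exact Finset.sum_congr rfl fun j _ => mul_comm _ _
    rw [e']
    refine Finset.sum_congr rfl fun i _ =>
      fderiv_apply_eq_of_affine (differentiableAt_smooth _ x) fun t => ?_
    simp only [linearCoord_apply, mulRightL_apply]
    rw [Θ.apply_add_of_corner _ _ _ (hcorner _ _), mul_add, map_add, Matrix.mul_smul, map_smul,
      smul_eq_mul, hA]
    simp only [mul_assoc]

end CornerFunctions

/-! ### First constraint on the support, from equivariance. -/

section SupportConstraint

variable {K : Type*} [RCLike K] {κ : K →ₗ[ℝ] ℝ} {f : 𝓓'(GLOpen K, ℂ)} {k l : ℕ} {x₀ Θ₀ : Mat K}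

lemma IsKernelMatrix.smul (h : IsKernelMatrix k l x₀ Θ₀) (c : K) :
    IsKernelMatrix k l x₀ (c • Θ₀) :=
  ⟨by rw [Matrix.mul_smul, h.left], by rw [Matrix.smul_mul, h.right],
    by rw [Matrix.mul_smul, h.mul_left, smul_zero],
    by rw [Matrix.smul_mul, Matrix.smul_mul, h.mul_right, smul_zero]⟩

lemma exists_isCompact_nhds {P : Mat K → Prop} (h : ∀ᶠ x in 𝓝 x₀, P x) :
    ∃ C ∈ 𝓝 x₀, IsCompact C ∧ ∀ x ∈ C, P x := by
  have : ProperSpace (Mat K) := FiniteDimensional.proper ℝ (Mat K)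
  obtain ⟨C, hC, hCP, hCc⟩ := local_compact_nhds h
  exact ⟨C, hC, hCc, hCP⟩

lemma not_isVanishingOn_of_mem_nhds (hx₀ : x₀ ∈ dsupport f) {C : Set (Mat K)} (hC : C ∈ 𝓝 x₀) :
    ¬ IsVanishingOn f C := by
  obtain ⟨U, hUC, hU, hxU⟩ := mem_nhds_iff.mp hC
  exact fun h => (mem_dsupport_iff_not_isVanishingOn x₀).mp hx₀ U hxU hU (h.mono hUC)

lemma eventually_det_ne_zero (hdet : x₀.det ≠ 0) : ∀ᶠ x in 𝓝 x₀, x.det ≠ 0 :=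
  (GLOpen K).2.mem_nhds hdet

/-- The equivariance constrains the support where the rank of a corner is locally maximal. -/
lemma trace_kernelMatrix_eq_zero (hκ : κ ≠ 0)
    (hL : IsLeftEigen κ k (f : 𝓓(GLOpen K, ℝ) →ₗ[ℝ] ℂ))
    (hR : IsRightEigen κ l (f : 𝓓(GLOpen K, ℝ) →ₗ[ℝ] ℂ))
    (hx₀ : x₀ ∈ dsupport f) (hdet : x₀.det ≠ 0)
    (hmax : ∀ᶠ x in 𝓝 x₀, x ∈ dsupport f → (corner k l x).rank ≤ (corner k l x₀).rank)
    (hΘ₀ : IsKernelMatrix k l x₀ Θ₀) :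
    (Θ₀ * (shift K * x₀ - x₀ * (shift K).transpose)).trace = 0 := by
  classical
  by_contra hne
  set τ := (Θ₀ * (shift K * x₀ - x₀ * (shift K).transpose)).trace with hτ
  obtain ⟨z, hz⟩ : ∃ z, κ z ≠ 0 := by
    by_contra! h
    exact hκ (LinearMap.ext h)
  -- `κ` is only real linear and may kill `τ`. After this rescaling the trace is `z`, and `κ z ≠ 0`.
  obtain ⟨Θ⟩ := nonempty_kernelFamily (hΘ₀.smul (z / τ))
  set p : smoothFunctions (Mat K) :=
    linearCoord (-characterForm κ (shift K)) _ (Θ.contDiff_mul_left.sub Θ.contDiff_left) -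
    linearCoord (-characterForm κ (shift K).transpose) _
      (Θ.contDiff_mul_right.sub Θ.contDiff_right) with hp
  have hpx : p.1 x₀ ≠ 0 := by
    change (-characterForm κ (shift K)) (x₀ * Θ.toFun x₀ - lowerProj K k * x₀ * Θ.toFun x₀) -
      (-characterForm κ (shift K).transpose) (Θ.toFun x₀ * x₀ - Θ.toFun x₀ * x₀ * lowerProj K l) ≠ 0
    have h1 := (hΘ₀.smul (z / τ)).mul_left
    have h2 := (hΘ₀.smul (z / τ)).mul_right
    rw [Θ.apply_base, h1, h2, sub_zero, sub_zero, LinearMap.neg_apply, LinearMap.neg_apply,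
      characterForm_apply, characterForm_apply, neg_sub_neg, ← map_sub, Matrix.smul_mul,
      Matrix.mul_smul, Matrix.mul_smul, Matrix.mul_smul, Matrix.trace_smul, Matrix.trace_smul,
      ← smul_sub]
    have h3 : ((shift K).transpose * (Θ₀ * x₀)).trace - (shift K * (x₀ * Θ₀)).trace = -τ := by
      rw [hτ, mul_sub, Matrix.trace_sub, ← mul_assoc, ← mul_assoc, Matrix.trace_mul_comm _ Θ₀,
        neg_sub, mul_assoc (shift K).transpose, Matrix.trace_mul_comm (shift K).transpose, mul_assoc]
    rw [h3, smul_eq_mul, mul_neg, div_mul_cancel₀ _ hne, map_neg]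
    exact neg_ne_zero.mpr hz
  have hpn : ∀ᶠ x in 𝓝 x₀, p.1 x ≠ 0 :=
    (contDiff_smooth p).continuous.continuousAt.eventually_ne hpx
  obtain ⟨C, hCn, hCc, hC⟩ :=
    exists_isCompact_nhds (hpn.and ((eventually_det_ne_zero hdet).and hmax))
  have hCΩ : C ⊆ GLOpen K := fun x hx => (hC x hx).2.1
  have hker (x : Mat K) (hx : x ∈ C) (hxf : x ∈ dsupport f) : IsKernelMatrix k l x (Θ.toFun x) :=
    Θ.isKernelMatrix x ((hC x hx).2.2 hxf)
  let b := Module.finBasis ℝ (Mat K)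
  let s : Finset (smoothFunctions (Mat K)) :=
    Finset.univ.image (fun j => linearCoord (b.coord j) _ Θ.contDiff_left) ∪
      Finset.univ.image (fun j => linearCoord (b.coord j) _ Θ.contDiff_right)
  have hs1 (j) : linearCoord (b.coord j) _ Θ.contDiff_left ∈ s :=
    Finset.mem_union_left _ (Finset.mem_image_of_mem _ (Finset.mem_univ j))
  have hs2 (j) : linearCoord (b.coord j) _ Θ.contDiff_right ∈ s :=
    Finset.mem_union_right _ (Finset.mem_image_of_mem _ (Finset.mem_univ j))
  have hsc : (s : Set (smoothFunctions (Mat K))) ⊆ cornerFunctions K k l := by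
    intro q hq
    rcases Finset.mem_union.mp hq with hq | hq <;> obtain ⟨j, -, rfl⟩ := Finset.mem_image.mp hq
    · exact Θ.left_mem_cornerFunctions _
    · exact Θ.right_mem_cornerFunctions _
  -- The entries of `π x Θ` and `Θ x ρ` vanish on the support only, so they are merely nilpotent on
  -- `f`. The multiple `Q f` is nonzero and exactly annihilated.
  obtain ⟨Q, hQ, hQC, hQs⟩ := exists_mul_annihilates (C := C)
    (F := (f : 𝓓(GLOpen K, ℝ) →ₗ[ℝ] ℂ)) (not_isVanishingOn_of_mem_nhds hx₀ hCn) s (by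
      intro q hq
      refine exists_pow_annihilates f hCc hCΩ q fun x hx hxf => ?_
      rcases Finset.mem_union.mp hq with hq | hq <;> obtain ⟨j, -, rfl⟩ := Finset.mem_image.mp hq
      · rw [linearCoord_apply, (hker x hx hxf).mul_left, map_zero]
      · rw [linearCoord_apply, (hker x hx hxf).mul_right, map_zero])
  have hQ' : Q ∈ cornerFunctions K k l := Submonoid.closure_le.mpr hsc hQ
  refine hQC (isVanishingOn_of_annihilates (q := p) (fun φ hφ => ?_) fun x hx => (hC x hx).1)
  -- Both evaluations concern the same field, so their difference `p` annihilates `Q f`, although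
  -- `p` has no zero on `C`.
  have e1 := Θ.apply_sandwich_left (hL.comp_mulSmooth hQ') (fun j => hQs _ (hs1 j)) φ hφ
  have e2 := Θ.apply_sandwich_right (hR.comp_mulSmooth hQ') (fun j => hQs _ (hs2 j)) φ hφ
  rw [e1] at e2
  have e3 := mul_left_cancel₀ Complex.I_ne_zero e2
  rw [hp, map_sub, LinearMap.sub_apply, map_sub, e3, sub_self]

end SupportConstraint

/-! ### Second constraint on the support, from the Casimir operator. -/

section Characteristic

/-- Up to cyclic rotation, every product in the expansion other than the two squares on the right
contains `Θ y Θ`, `G y Θ` or `Θ y G`. Thus the terms in `T`, which come from the variation of `Θ`,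
do not contribute. -/
lemma trace_sq_eq {n R : Type*} [Fintype n] [CommRing R] {Θ G T y J N : Matrix n n R}
    (h1 : Θ * y * Θ = 0) (h2 : G * y * Θ = 0) (h3 : Θ * y * G = 0) :
    ((Θ * J - N * Θ - Θ * T * G - G * T * Θ) * y *
      ((Θ * J - N * Θ - Θ * T * G - G * T * Θ) * y)).trace =
    (Θ * (J * y) * (Θ * (J * y))).trace + (Θ * (y * N) * (Θ * (y * N))).trace := by
  have h1' (z : Matrix n n R) : Θ * (y * (Θ * z)) = 0 := by
    rw [← mul_assoc, ← mul_assoc, h1, zero_mul]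
  have h2' (z : Matrix n n R) : G * (y * (Θ * z)) = 0 := by
    rw [← mul_assoc, ← mul_assoc, h2, zero_mul]
  have h3' (z : Matrix n n R) : Θ * (y * (G * z)) = 0 := by
    rw [← mul_assoc, ← mul_assoc, h3, zero_mul]
  have e1 := Matrix.trace_mul_comm (Θ * (J * y)) (N * (Θ * y))
  have e2 := Matrix.trace_mul_comm (Θ * (J * y)) (Θ * (T * (G * y)))
  have e3 := Matrix.trace_mul_comm (Θ * (J * y)) (G * (T * (Θ * y)))
  have e4 := Matrix.trace_mul_comm (N * (Θ * y)) (Θ * (T * (G * y)))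
  have e5 := Matrix.trace_mul_comm (Θ * (T * (G * y))) (G * (T * (Θ * y)))
  have e6 := Matrix.trace_mul_comm (N * (Θ * y)) (G * (T * (Θ * y)))
  have e7 := Matrix.trace_mul_comm N (Θ * (y * (N * (Θ * y))))
  simp only [mul_assoc, h1', h2', h3', mul_zero, Matrix.trace_zero] at e1 e2 e3 e4 e5 e6 e7
  simp only [sub_mul, mul_sub, mul_assoc, Matrix.trace_sub, h1', h2', h3', mul_zero,
    Matrix.trace_zero, e1, e2, e3, ← e4, e5, ← e6, e7]
  ring

variable {K : Type*} [RCLike K]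

/-- This evaluates the symbol of the Casimir operator on the covector represented by `Z`. -/
lemma sum_traceForm_mul (Z : Mat K) :
    ∑ i, traceForm K (Module.finBasis ℝ (Mat K) i) Z *
      traceForm K ((traceForm K).dualBasis (traceForm_nondegenerate K)
        (Module.finBasis ℝ (Mat K)) i) Z = traceForm K Z Z := by
  set b' := (traceForm K).dualBasis (traceForm_nondegenerate K) (Module.finBasis ℝ (Mat K)) with hb'
  have h := sum_coord_smul_apply b' ((traceForm K).flip Z) Z
  change _ = traceForm K Z Z at h
  rw [← h]
  refine Finset.sum_congr rfl fun i _ => ?_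
  have e : b'.coord i Z = traceForm K (Module.finBasis ℝ (Mat K) i) Z := by
    rw [Module.Basis.coord_apply, hb', LinearMap.BilinForm.dualBasis_repr_apply]
    exact congrArg RCLike.re (Matrix.trace_mul_comm _ _)
  rw [e]
  rfl

/-- One of `c = 1` and `c = 1 + i` works. The real symbol sees only a real part, and scaling the
defining function by `c` rotates it. -/
lemma exists_re_sq_mul_ne_zero {t : K} (ht : t ≠ 0) : ∃ c : K, RCLike.re (c * c * t) ≠ 0 := by
  by_contra! h
  have h1 : RCLike.re t = 0 := by simpa using h 1
  have h2 : RCLike.im t ≠ 0 := fun h2 => ht (RCLike.ext (by rw [h1, map_zero]) (by rw [h2, map_zero]))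
  have h3 := h (1 + RCLike.I)
  have e : (1 + RCLike.I) * (1 + RCLike.I) * t =
      t + (RCLike.I * t + RCLike.I * t) + RCLike.I * RCLike.I * t := by ring
  rw [e] at h3
  rcases RCLike.I_mul_I (K := K) with h0 | h0
  · exact h2 (RCLike.im_eq_zero h0 t)
  · rw [h0, neg_one_mul] at h3
    simp only [map_add, map_neg, RCLike.I_mul_re, h1] at h3
    exact h2 (by linarith)

lemma casimir_apply (F : 𝓓(GLOpen K, ℝ) →ₗ[ℝ] ℂ) (φ : 𝓓(GLOpen K, ℝ)) :
    casimir F φ = F (∑ i, vectorField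
      (mulRightL ((traceForm K).dualBasis (traceForm_nondegenerate K)
        (Module.finBasis ℝ (Mat K)) i)) (ContinuousLinearMap.contDiff _)
      (vectorField (mulRightL (Module.finBasis ℝ (Mat K) i)) (ContinuousLinearMap.contDiff _) φ)) := by
  rw [casimir, LinearMap.sum_apply, map_sum]
  refine Finset.sum_congr rfl fun i _ => ?_
  simp only [leftDeriv, LinearMap.neg_comp, neg_neg]
  rfl

variable {f : 𝓓'(GLOpen K, ℂ)} {k l : ℕ} {x₀ Θ₀ : Mat K}

/-- The eigenvalue equation constrains the support further: the functions vanishing on the support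
have isotropic differentials for the quadratic form given by the symbol of the Casimir operator. -/
lemma trace_sq_kernelMatrix_eq_zero {μ : ℂ}
    (hΔ : casimir (f : 𝓓(GLOpen K, ℝ) →ₗ[ℝ] ℂ) = μ • (f : 𝓓(GLOpen K, ℝ) →ₗ[ℝ] ℂ))
    (hx₀ : x₀ ∈ dsupport f) (hdet : x₀.det ≠ 0)
    (hmax : ∀ᶠ x in 𝓝 x₀, x ∈ dsupport f → (corner k l x).rank ≤ (corner k l x₀).rank)
    (htr : ∀ᶠ x in 𝓝 x₀, x ∈ dsupport f → ∀ Θ, IsKernelMatrix k l x Θ →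
      (Θ * (shift K * x - x * (shift K).transpose)).trace = 0)
    (hΘ₀ : IsKernelMatrix k l x₀ Θ₀) :
    (Θ₀ * (shift K * x₀) * (Θ₀ * (shift K * x₀))).trace +
      (Θ₀ * (x₀ * (shift K).transpose) * (Θ₀ * (x₀ * (shift K).transpose))).trace = 0 := by
  by_contra hne
  set J := shift K
  set τ := (Θ₀ * (J * x₀) * (Θ₀ * (J * x₀))).trace +
      (Θ₀ * (x₀ * J.transpose) * (Θ₀ * (x₀ * J.transpose))).trace with hτ
  obtain ⟨c, hc⟩ := exists_re_sq_mul_ne_zero hne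
  obtain ⟨Θ⟩ := nonempty_kernelFamily hΘ₀
  set T := J * x₀ - x₀ * J.transpose with hT
  set Ξ := Θ₀ * J - J.transpose * Θ₀ - Θ₀ * T * Θ.inv - Θ.inv * T * Θ₀ with hΞ
  have hYs : ContDiff ℝ ∞ fun x : Mat K => J * x - x * J.transpose :=
    (contDiff_matrix_mul contDiff_const contDiff_id).sub
      (contDiff_matrix_mul contDiff_id contDiff_const)
  let L : Mat K →ₗ[ℝ] ℝ := RCLike.reLm ∘ₗ LinearMap.mulLeft ℝ c ∘ₗ Matrix.traceLinearMap (Fin 6) ℝ K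
  have hL (y : Mat K) : L y = RCLike.re (c * y.trace) := rfl
  set p : smoothFunctions (Mat K) :=
    linearCoord L (fun x => Θ.toFun x * (J * x - x * J.transpose))
      (contDiff_matrix_mul Θ.contDiff hYs) with hp
  have hdp (X : Mat K) : fderiv ℝ p.1 x₀ X = RCLike.re (c * (X * Ξ).trace) := by
    refine fderiv_apply_eq_of_line (differentiableAt_smooth p x₀) ?_
    obtain ⟨s, hs⟩ := Θ.hasDerivAt X
    have hline : HasDerivAt (fun t : ℝ => J * (x₀ + t • X) - (x₀ + t • X) * J.transpose)
        (J * X - X * J.transpose) 0 := by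
      have e : (fun t : ℝ => J * (x₀ + t • X) - (x₀ + t • X) * J.transpose) =
          fun t : ℝ => T + t • (J * X - X * J.transpose) := by
        funext t
        simp only [hT, mul_add, add_mul, Matrix.mul_smul, Matrix.smul_mul, smul_sub]
        abel
      rw [e]
      simpa using ((hasDerivAt_id (0 : ℝ)).smul_const (J * X - X * J.transpose)).const_add T
    have hprod := (LinearMap.toContinuousLinearMap L).hasFDerivAt.comp_hasDerivAt (0 : ℝ)
      (hasDerivAt_matrix_mul hs hline)
    refine hprod.congr_deriv ?_
    rw [LinearMap.coe_toContinuousLinearMap', hL]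
    congr 2
    -- By the first constraint at `x₀`, the undetermined scalar `s` in the derivative of the family
    -- drops out.
    have h0 : (Θ₀ * T).trace = 0 := htr.self_of_nhds hx₀ Θ₀ hΘ₀
    simp only [zero_smul, add_zero, Θ.apply_base, ← hT]
    have e1 : (Θ.inv * X * Θ₀ * T).trace = (X * (Θ₀ * T * Θ.inv)).trace := by
      rw [mul_assoc, mul_assoc, Matrix.trace_mul_comm]
      simp only [mul_assoc]
    have e2 : (Θ₀ * X * Θ.inv * T).trace = (X * (Θ.inv * T * Θ₀)).trace := by
      rw [mul_assoc, mul_assoc, Matrix.trace_mul_comm]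
      simp only [mul_assoc]
    have e3 : (Θ₀ * (J * X)).trace = (X * (Θ₀ * J)).trace := by
      rw [← mul_assoc, Matrix.trace_mul_comm]
    have e4 : (Θ₀ * (X * J.transpose)).trace = (X * (J.transpose * Θ₀)).trace := by
      rw [Matrix.trace_mul_comm, mul_assoc]
    simp only [hΞ, sub_mul, mul_sub, Matrix.trace_sub, Matrix.trace_add, Matrix.smul_mul,
      Matrix.trace_smul, h0, e1, e2, e3, e4, smul_zero]
    ring
  set b := Module.finBasis ℝ (Mat K)
  set b' := (traceForm K).dualBasis (traceForm_nondegenerate K) b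
  set Γ : Mat K → ℝ := fun x => ∑ i, fderiv ℝ p.1 x (mulRightL (b i) x) *
    fderiv ℝ p.1 x (mulRightL (b' i) x) with hΓ
  have hΓc : Continuous Γ := by
    have h (B : Mat K) : Continuous fun x => fderiv ℝ p.1 x (mulRightL B x) :=
      (contDiff_smooth (derivAlong _ (mulRightL B).contDiff p)).continuous
    exact continuous_finsetSum _ fun i _ => (h _).mul (h _)
  -- The differential of `p` along `x₀ B` is the trace form of `B` with `c Ξ x₀`. Summing over dual
  -- bases gives `Re (c² tr ((Ξ x₀)²))`, which `trace_sq_eq` turns into `Re (c² τ)`.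
  have hΓ0 : Γ x₀ ≠ 0 := by
    have e (B : Mat K) : fderiv ℝ p.1 x₀ (mulRightL B x₀) = traceForm K B (c • (Ξ * x₀)) := by
      rw [hdp, mulRightL_apply]
      change _ = RCLike.re (B * c • (Ξ * x₀)).trace
      rw [Matrix.mul_smul, Matrix.trace_smul, smul_eq_mul, mul_assoc, Matrix.trace_mul_comm x₀,
        mul_assoc]
    have e' : Γ x₀ = RCLike.re (c * c * τ) := by
      simp only [hΓ, e]
      rw [sum_traceForm_mul]
      change RCLike.re (c • (Ξ * x₀) * c • (Ξ * x₀)).trace = _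
      rw [Matrix.smul_mul, Matrix.mul_smul, Matrix.trace_smul, Matrix.trace_smul, smul_eq_mul,
        smul_eq_mul, ← mul_assoc, hτ, hΞ, trace_sq_eq _ Θ.inv_mul Θ.mul_inv]
      rw [← hΘ₀.right, mul_assoc, mul_assoc, ← mul_assoc _ x₀, hΘ₀.right, hΘ₀.mul_left, mul_zero]
    rwa [e']
  have hΓn : ∀ᶠ x in 𝓝 x₀, Γ x ≠ 0 := hΓc.continuousAt.eventually_ne hΓ0
  obtain ⟨C, hCn, hCc, hC⟩ :=
    exists_isCompact_nhds (hΓn.and ((eventually_det_ne_zero hdet).and (hmax.and htr)))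
  obtain ⟨N, hN⟩ := exists_pow_annihilates f hCc (fun x hx => (hC x hx).2.1) p (by
    intro x hx hxf
    obtain ⟨-, -, h1, h2⟩ := hC x hx
    rw [hp, linearCoord_apply, hL, h2 hxf _ (Θ.isKernelMatrix x (h1 hxf)), mul_zero, map_zero])
  refine not_isVanishingOn_of_mem_nhds hx₀ hCn (isVanishingOn_of_noncharacteristic
    (F := (f : 𝓓(GLOpen K, ℝ) →ₗ[ℝ] ℂ)) (μ := μ) (fun i => mulRightL (b i))
    (fun i => mulRightL (b' i)) (fun i => ContinuousLinearMap.contDiff _)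
    (fun i => ContinuousLinearMap.contDiff _) (fun φ => ?_) p hN fun x hx => (hC x hx).1)
  rw [← casimir_apply, hΔ]
  rfl

end Characteristic

/-! ### Linear algebra of the constraints. -/

section LinearAlgebra

open Matrix

variable {K : Type*} [RCLike K] {x : Mat K}

/-- The conditions imposed on the points of the support by the vectors in the left and right
kernels of the lower right corners. -/
def IsConstrained (x : Mat K) : Prop :=
  ∀ k ∈ ({1, 2} : Set ℕ), ∀ l ∈ ({1, 2} : Set ℕ), ∀ u w : Fin 6 → K,
    (∀ i, i.val < 2 * l → u i = 0) → (∀ i, i.val < 2 * k → w i = 0) →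
    (∀ i, 2 * k ≤ i.val → (x *ᵥ u) i = 0) → (∀ j, 2 * l ≤ j.val → (w ᵥ* x) j = 0) →
    w 2 * (x *ᵥ u) 0 + w 3 * (x *ᵥ u) 1 + w 4 * (x *ᵥ u) 2 + w 5 * (x *ᵥ u) 3 = 0 ∧
    (w ᵥ* x) 0 * u 2 + (w ᵥ* x) 1 * u 3 + (w ᵥ* x) 2 * u 4 + (w ᵥ* x) 3 * u 5 = 0

/-- Transposition swaps `k` with `l`, `u` with `w`, and the two equations with each other. -/
lemma IsConstrained.transpose (h : IsConstrained x) : IsConstrained xᵀ := by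
  intro k hk l hl u w hu hw hxu hwx
  rw [mulVec_transpose] at hxu ⊢
  rw [vecMul_transpose] at hwx ⊢
  obtain ⟨h1, h2⟩ := h l hl k hk w u hw hu hwx hxu
  exact ⟨by linear_combination h2, by linear_combination h1⟩

lemma eq_of_lt_two : ∀ i : Fin 6, i.val < 2 → i = 0 ∨ i = 1 := by decide

lemma eq_of_four_le : ∀ i : Fin 6, 4 ≤ i.val → i = 4 ∨ i = 5 := by decide

lemma eq_of_two_le : ∀ i : Fin 6, 2 ≤ i.val → i = 2 ∨ i = 3 ∨ i = 4 ∨ i = 5 := by decide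

lemma eq_zero_of_vecMul_eq_zero (hdet : x.det ≠ 0) {w : Fin 6 → K} (h : ∀ j, (w ᵥ* x) j = 0) :
    w = 0 := by
  by_contra hw
  exact hdet (exists_vecMul_eq_zero_iff.mp ⟨w, hw, funext h⟩)

lemma eq_zero_of_mulVec_eq_zero (hdet : x.det ≠ 0) {u : Fin 6 → K} (h : ∀ i, (x *ᵥ u) i = 0) :
    u = 0 := by
  by_contra hu
  exact hdet (exists_mulVec_eq_zero_iff.mp ⟨u, hu, funext h⟩)

lemma exists_combination_of_forall {ι n F : Type*} [Fintype ι] [Fintype n] [Field F]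
    (L : ι → (n → F) →ₗ[F] F) (ℓ : (n → F) →ₗ[F] F) (h : ∀ u, (∀ i, L i u = 0) → ℓ u = 0) :
    ∃ c : ι → F, ∀ u, ℓ u = ∑ i, c i * L i u := by
  have h1 := mem_span_of_iInf_ker_le_ker (L := L) (K := ℓ) fun u hu => by
    simp only [Submodule.mem_iInf, LinearMap.mem_ker] at hu
    exact h u hu
  obtain ⟨c, hc⟩ := (Submodule.mem_span_range_iff_exists_fun F).mp h1
  exact ⟨c, fun u => by simp [← hc]⟩

lemma vecMul_apply_of_support {w : Fin 6 → K} (hw : ∀ i, i.val < 4 → w i = 0) (j : Fin 6) :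
    (w ᵥ* x) j = w 4 * x 4 j + w 5 * x 5 j := by
  have h0 := hw 0 (by decide)
  have h1 := hw 1 (by decide)
  have h2 := hw 2 (by decide)
  have h3 := hw 3 (by decide)
  simp [vecMul, dotProduct, Fin.sum_univ_six, h0, h1, h2, h3]

/-- The last two rows are linearly independent modulo the first two coordinates. -/
lemma IsConstrained.eq_zero_of_vecMul (h : IsConstrained x) (hdet : x.det ≠ 0) {w : Fin 6 → K}
    (hw : ∀ i, i.val < 4 → w i = 0) (hwx : ∀ j, 2 ≤ j.val → (w ᵥ* x) j = 0) : w = 0 := by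
  have key : (w ᵥ* x) 0 = 0 ∧ (w ᵥ* x) 1 = 0 → w = 0 := by
    rintro ⟨h0, h1⟩
    refine eq_zero_of_vecMul_eq_zero hdet fun j => ?_
    by_cases hj : 2 ≤ j.val
    · exact hwx j hj
    · obtain rfl | rfl := eq_of_lt_two j (by omega)
      · exact h0
      · exact h1
  by_contra hne
  set a := w ᵥ* x with ha
  -- By the constraint for `(k, l) = (2, 1)`, the form `a 0 u 2 + a 1 u 3` vanishes on all
  -- admissible `u`. By duality some combination `v` of the last two rows of `x` has entries `a 0, a
  -- 1, 0, 0` in the last four columns.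
  obtain ⟨c, hc⟩ := exists_combination_of_forall
    ![LinearMap.proj (R := K) (φ := fun _ : Fin 6 => K) 0, LinearMap.proj 1,
      LinearMap.proj 4 ∘ₗ x.mulVecLin, LinearMap.proj 5 ∘ₗ x.mulVecLin]
    (a 0 • LinearMap.proj 2 + a 1 • LinearMap.proj 3) (by
      intro u hu
      have h0 := hu 0
      have h1 := hu 1
      have h4 := hu 2
      have h5 := hu 3
      change u 0 = 0 at h0
      change u 1 = 0 at h1
      change (x *ᵥ u) 4 = 0 at h4
      change (x *ᵥ u) 5 = 0 at h5
      have h2 := (h 2 (by simp) 1 (by simp) u w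
        (fun i hi => by rcases eq_of_lt_two i hi with rfl | rfl <;> assumption) hw
        (fun i hi => by rcases eq_of_four_le i hi with rfl | rfl <;> assumption) hwx).2
      rw [← ha, hwx 2 le_rfl, hwx 3 (by decide)] at h2
      change a 0 * u 2 + a 1 * u 3 = 0
      linear_combination h2)
  have hc' (u : Fin 6 → K) : a 0 * u 2 + a 1 * u 3 =
      c 0 * u 0 + c 1 * u 1 + c 2 * (x *ᵥ u) 4 + c 3 * (x *ᵥ u) 5 := by
    have h1 := hc u
    rw [Fin.sum_univ_four] at h1
    exact h1
  set v : Fin 6 → K := ![0, 0, 0, 0, c 2, c 3] with hv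
  have hv4 : ∀ i : Fin 6, i.val < 4 → v i = 0 := by
    intro i hi
    match i with
    | 0 => rfl
    | 1 => rfl
    | 2 => rfl
    | 3 => rfl
    | 4 => exact absurd hi (by decide)
    | 5 => exact absurd hi (by decide)
  have hvx (j : Fin 6) : (v ᵥ* x) j = c 2 * x 4 j + c 3 * x 5 j :=
    vecMul_apply_of_support hv4 j
  have hax (j : Fin 6) : a j = w 4 * x 4 j + w 5 * x 5 j := vecMul_apply_of_support hw j
  have hcol (j : Fin 6) : a 0 * (Pi.single j 1 : Fin 6 → K) 2 + a 1 * (Pi.single j 1 : Fin 6 → K) 3 =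
      c 0 * (Pi.single j 1 : Fin 6 → K) 0 + c 1 * (Pi.single j 1 : Fin 6 → K) 1 +
      c 2 * x 4 j + c 3 * x 5 j := by
    rw [hc', mulVec_single_one]
    rfl
  have v2 : a 0 = c 2 * x 4 2 + c 3 * x 5 2 := by simpa using hcol 2
  have v3 : a 1 = c 2 * x 4 3 + c 3 * x 5 3 := by simpa using hcol 3
  have v4 : 0 = c 2 * x 4 4 + c 3 * x 5 4 := by simpa using hcol 4
  have v5 : 0 = c 2 * x 4 5 + c 3 * x 5 5 := by simpa using hcol 5
  have a2 := hax 2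
  have a3 := hax 3
  have a4 := hax 4
  have a5 := hax 5
  rw [hwx _ (by decide)] at a2 a3 a4 a5
  have ha01 : a 0 = 0 ∧ a 1 = 0 := by
    -- If `v` is proportional to `w`, then `v x` vanishes in the last four columns, so `a 0 = a 1 =
    -- 0`. Otherwise two independent combinations kill columns `4` and `5` of the last two rows, so
    -- the lower right `2 × 2` block is zero. Then the constraint for `(2, 2)`, with `u` a basis
    -- vector, gives `a 0 = a 1 = 0` again.
    by_cases hΔ : c 2 * w 5 - c 3 * w 4 = 0
    · have hw45 : w 4 ≠ 0 ∨ w 5 ≠ 0 := by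
        by_contra! h45
        refine hne (funext fun i => ?_)
        by_cases hi : i.val < 4
        · exact hw i hi
        · rcases eq_of_four_le i (by omega) with rfl | rfl
          exacts [h45.1, h45.2]
      rcases hw45 with h4 | h5
      · exact ⟨mul_left_cancel₀ h4 (by linear_combination w 4 * v2 - c 2 * a2 - x 5 2 * hΔ),
          mul_left_cancel₀ h4 (by linear_combination w 4 * v3 - c 2 * a3 - x 5 3 * hΔ)⟩
      · exact ⟨mul_left_cancel₀ h5 (by linear_combination w 5 * v2 - c 3 * a2 + x 4 2 * hΔ),
          mul_left_cancel₀ h5 (by linear_combination w 5 * v3 - c 3 * a3 + x 4 3 * hΔ)⟩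
    · have z44 : x 4 4 = 0 := mul_left_cancel₀ hΔ (by linear_combination c 3 * a4 - w 5 * v4)
      have z54 : x 5 4 = 0 := mul_left_cancel₀ hΔ (by linear_combination w 4 * v4 - c 2 * a4)
      have z45 : x 4 5 = 0 := mul_left_cancel₀ hΔ (by linear_combination c 3 * a5 - w 5 * v5)
      have z55 : x 5 5 = 0 := mul_left_cancel₀ hΔ (by linear_combination w 4 * v5 - c 2 * a5)
      have hv' : ∀ j : Fin 6, 4 ≤ j.val → (v ᵥ* x) j = 0 := by
        intro j hj
        rw [hvx]
        rcases eq_of_four_le j hj with rfl | rfl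
        exacts [v4.symm, v5.symm]
      have h1 := (h 2 (by simp) 2 (by simp) (Pi.single 4 1) v
        (fun i hi => Pi.single_eq_of_ne (by rintro rfl; exact absurd hi (by decide)) _) hv4
        (fun i hi => by
          rw [mulVec_single_one]
          rcases eq_of_four_le i hi with rfl | rfl
          exacts [z44, z54]) hv').2
      have h2 := (h 2 (by simp) 2 (by simp) (Pi.single 5 1) v
        (fun i hi => Pi.single_eq_of_ne (by rintro rfl; exact absurd hi (by decide)) _) hv4
        (fun i hi => by
          rw [mulVec_single_one]
          rcases eq_of_four_le i hi with rfl | rfl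
          exacts [z45, z55]) hv').2
      simp only [hvx, ← v2, ← v3] at h1 h2
      exact ⟨by simpa using h1, by simpa using h2⟩
  exact hne (key ha01)

/-- The lower right `2 × 2` block does not vanish. -/
lemma IsConstrained.exists_ne_zero (h : IsConstrained x) (hdet : x.det ≠ 0) :
    ∃ i j : Fin 6, 4 ≤ i.val ∧ 4 ≤ j.val ∧ x i j ≠ 0 := by
  by_contra! hz
  have hw : ∀ i : Fin 6, i.val < 4 → (Pi.single 4 1 : Fin 6 → K) i = 0 := fun i hi =>
    Pi.single_eq_of_ne (by rintro rfl; exact absurd hi (by decide)) _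
  have hu5 : ∀ i : Fin 6, i.val < 4 → (Pi.single 5 1 : Fin 6 → K) i = 0 := fun i hi =>
    Pi.single_eq_of_ne (by rintro rfl; exact absurd hi (by decide)) _
  have hwx (j : Fin 6) : ((Pi.single 4 1 : Fin 6 → K) ᵥ* x) j = x 4 j := by
    rw [single_one_vecMul]
    rfl
  have hwx4 : ∀ j : Fin 6, 4 ≤ j.val → ((Pi.single 4 1 : Fin 6 → K) ᵥ* x) j = 0 := fun j hj => by
    rw [hwx]
    exact hz 4 j (by decide) hj
  -- If the block vanished, the constraint for `(2, 2)` would also kill the entries of row `4` in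
  -- columns `2` and `3`, against `IsConstrained.eq_zero_of_vecMul`.
  have h1 := (h 2 (by simp) 2 (by simp) (Pi.single 4 1) (Pi.single 4 1) hw hw
    (fun i hi => by rw [mulVec_single_one]; exact hz i 4 hi (by decide)) hwx4).2
  have h2 := (h 2 (by simp) 2 (by simp) (Pi.single 5 1) (Pi.single 4 1) hu5 hw
    (fun i hi => by rw [mulVec_single_one]; exact hz i 5 hi (by decide)) hwx4).2
  simp only [hwx] at h1 h2
  have h3 : x 4 2 = 0 := by simpa using h1
  have h4 : x 4 3 = 0 := by simpa using h2
  have h5 := h.eq_zero_of_vecMul hdet hw fun j hj => by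
    rw [hwx]
    rcases eq_of_two_le j hj with rfl | rfl | rfl | rfl
    exacts [h3, h4, hz 4 4 (by decide) (by decide), hz 4 5 (by decide) (by decide)]
  exact one_ne_zero (α := K) (by simpa using congrFun h5 4)

end LinearAlgebra

/-! ### From the constraints to the rank conditions defining `GPrime`. -/

section Ranks

open Matrix

variable {K : Type*} [RCLike K] {x : Mat K}

/-- Extension by zero of a vector indexed by a subtype. -/
def extendZero (p : Fin 6 → Prop) [DecidablePred p] (v : {i // p i} → K) : Fin 6 → K :=
  fun i => if h : p i then v ⟨i, h⟩ else 0

lemma extendZero_of_not {p : Fin 6 → Prop} [DecidablePred p] (v : {i // p i} → K) {i : Fin 6}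
    (h : ¬ p i) : extendZero p v i = 0 := dif_neg h

lemma extendZero_coe {p : Fin 6 → Prop} [DecidablePred p] (v : {i // p i} → K) (i : {i // p i}) :
    extendZero p v i = v i := dif_pos i.2

lemma vecMul_extendZero {p q : Fin 6 → Prop} [DecidablePred p] (v : {i // p i} → K)
    (j : {i // q i}) : (extendZero p v ᵥ* x) j = (v ᵥ* x.toBlock p q) j := by
  have h := Fintype.sum_subtype_add_sum_subtype p fun i => extendZero p v i * x i j
  rw [Finset.sum_eq_zero (s := (Finset.univ : Finset {i // ¬ p i}))
    fun i _ => by rw [extendZero_of_not v i.2, zero_mul], add_zero] at h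
  refine h.symm.trans (Finset.sum_congr rfl fun i _ => ?_)
  rw [extendZero_coe]
  rfl

lemma mulVec_extendZero {p q : Fin 6 → Prop} [DecidablePred q] (v : {i // q i} → K)
    (i : {i // p i}) : (x *ᵥ extendZero q v) i = (x.toBlock p q *ᵥ v) i := by
  rw [← vecMul_transpose, ← vecMul_transpose]
  exact vecMul_extendZero (x := xᵀ) v i

lemma lrRank_transpose (i j : ℕ) (x : Mat K) : lrRank i j xᵀ = lrRank j i x :=
  rank_transpose (x.toBlock (fun r => 6 ≤ r.val + j) (fun c => 6 ≤ c.val + i))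

lemma IsConstrained.lrRank_two_four (h : IsConstrained x) (hdet : x.det ≠ 0) :
    lrRank 2 4 x = 2 := by
  have hinj : Function.Injective
      (x.toBlock (fun r : Fin 6 => 6 ≤ r.val + 2) (fun c : Fin 6 => 6 ≤ c.val + 4)).vecMul := by
    refine (injective_iff_map_eq_zero (vecMulLinear
      (x.toBlock (fun r : Fin 6 => 6 ≤ r.val + 2) (fun c : Fin 6 => 6 ≤ c.val + 4)))).mpr
        fun w hw => ?_
    have h1 := h.eq_zero_of_vecMul hdet (w := extendZero _ w)
      (fun i hi => extendZero_of_not w (by omega)) fun j hj => by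
        rw [vecMul_extendZero (q := fun c : Fin 6 => 6 ≤ c.val + 4) w ⟨j, by omega⟩]
        exact congrFun hw _
    funext i
    rw [← extendZero_coe w i, h1]
    rfl
  rw [lrRank, (vecMul_injective_iff.mp hinj).rank_matrix]
  rfl

lemma IsConstrained.lrRank_two_two (h : IsConstrained x) (hdet : x.det ≠ 0) :
    1 ≤ lrRank 2 2 x := by
  obtain ⟨i, j, hi, hj, hx⟩ := h.exists_ne_zero hdet
  rw [Nat.one_le_iff_ne_zero]
  intro h0
  have h1 := LinearMap.range_eq_bot.mp (Submodule.finrank_eq_zero.mp h0)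
  have h2 := congrFun (LinearMap.congr_fun h1 (Pi.single ⟨j, by omega⟩ 1)) ⟨i, by omega⟩
  rw [mulVecLin_apply, mulVec_single_one] at h2
  exact hx h2

/-- If the rank were at most `2`, the left kernel `V` would have dimension at least `2`. By
`IsConstrained.eq_zero_of_vecMul` it embeds into its first two coordinates, so these take all values
on `V`. For a nonzero `u` in the right kernel the constraint for `(1, 1)` then forces `x u = 0`. -/
lemma IsConstrained.lrRank_four_four (h : IsConstrained x) (hdet : x.det ≠ 0) :
    3 ≤ lrRank 4 4 x := by
  by_contra hlt
  set D := x.toBlock (fun r : Fin 6 => 6 ≤ r.val + 4) (fun c : Fin 6 => 6 ≤ c.val + 4) with hD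
  have hrank : D.rank ≤ 2 := by
    change ¬ 3 ≤ D.rank at hlt
    omega
  have hcard : Module.finrank K ({r : Fin 6 // 6 ≤ r.val + 4} → K) = 4 := by
    rw [Module.finrank_fintype_fun_eq_card]
    rfl
  have e1 := D.mulVecLin.finrank_range_add_finrank_ker
  have e2 := Dᵀ.mulVecLin.finrank_range_add_finrank_ker
  change D.rank + _ = _ at e1
  change Dᵀ.rank + _ = _ at e2
  rw [rank_transpose, hcard] at e2
  rw [hcard] at e1
  obtain ⟨u, hu, hu0⟩ := (Submodule.ne_bot_iff _).mp
    (Submodule.one_le_finrank_iff.mp (show 1 ≤ Module.finrank K (LinearMap.ker D.mulVecLin) by omega))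
  let V := LinearMap.ker Dᵀ.mulVecLin
  let pr : V →ₗ[K] Fin 2 → K :=
    LinearMap.funLeft K K (fun i : Fin 2 => (⟨⟨i.val + 2, by omega⟩, by simp⟩ :
      {r : Fin 6 // 6 ≤ r.val + 4})) ∘ₗ V.subtype
  have hVx (w : V) (j : Fin 6) (hj : 2 ≤ j.val) :
      (extendZero (fun r : Fin 6 => 6 ≤ r.val + 4) w.1 ᵥ* x) j = 0 := by
    rw [vecMul_extendZero (q := fun c : Fin 6 => 6 ≤ c.val + 4) w.1 ⟨j, by omega⟩]
    have h1 := w.2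
    rw [LinearMap.mem_ker, mulVecLin_apply, mulVec_transpose] at h1
    exact congrFun h1 _
  have hpr0 (w : V) : extendZero (fun r : Fin 6 => 6 ≤ r.val + 4) w.1 2 = pr w 0 :=
    extendZero_coe w.1 ⟨2, by decide⟩
  have hpr1 (w : V) : extendZero (fun r : Fin 6 => 6 ≤ r.val + 4) w.1 3 = pr w 1 :=
    extendZero_coe w.1 ⟨3, by decide⟩
  have hinj : Function.Injective pr := by
    refine (injective_iff_map_eq_zero pr).mpr fun w hw => ?_
    have h1 := h.eq_zero_of_vecMul hdet (w := extendZero _ w.1) (fun i hi => ?_) (hVx w)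
    · refine Subtype.ext (funext fun i => ?_)
      rw [← extendZero_coe w.1 i, h1]
      rfl
    · by_cases hi2 : i.val < 2
      · exact extendZero_of_not w.1 (by omega)
      · obtain rfl | rfl : i = 2 ∨ i = 3 := by
          rcases eq_of_two_le i (by omega) with rfl | rfl | rfl | rfl
          exacts [Or.inl rfl, Or.inr rfl, absurd hi (by decide), absurd hi (by decide)]
        · rw [hpr0, hw]; rfl
        · rw [hpr1, hw]; rfl
  have hV2 : Module.finrank K V = Module.finrank K (Fin 2 → K) := by
    have h1 := LinearMap.finrank_le_finrank_of_injective hinj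
    rw [Module.finrank_fin_fun] at h1 ⊢
    change _ + Module.finrank K V = 4 at e2
    omega
  have hsurj := (LinearMap.injective_iff_surjective_of_finrank_eq_finrank hV2).mp hinj
  have hux (i : Fin 6) (hi : 2 ≤ i.val) :
      (x *ᵥ extendZero (fun r : Fin 6 => 6 ≤ r.val + 4) u) i = 0 := by
    rw [mulVec_extendZero (p := fun c : Fin 6 => 6 ≤ c.val + 4) u ⟨i, by omega⟩]
    exact congrFun hu _
  have key (w : V) : pr w 0 * (x *ᵥ extendZero _ u) 0 + pr w 1 * (x *ᵥ extendZero _ u) 1 = 0 := by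
    have h1 := (h 1 (by simp) 1 (by simp) (extendZero _ u) (extendZero _ w.1)
      (fun i hi => extendZero_of_not u (by omega)) (fun i hi => extendZero_of_not w.1 (by omega))
      hux (hVx w)).1
    rw [hux 2 le_rfl, hux 3 (by decide), hpr0, hpr1] at h1
    linear_combination h1
  obtain ⟨w0, hw0⟩ := hsurj ![1, 0]
  obtain ⟨w1, hw1⟩ := hsurj ![0, 1]
  have k0 := key w0
  have k1 := key w1
  rw [hw0] at k0
  rw [hw1] at k1
  refine hu0 ?_
  have h2 := eq_zero_of_mulVec_eq_zero hdet (u := extendZero _ u) fun i => by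
    by_cases hi : 2 ≤ i.val
    · exact hux i hi
    · rcases eq_of_lt_two i (by omega) with rfl | rfl
      · simpa using k0
      · simpa using k1
  funext i
  rw [← extendZero_coe u i, h2]
  rfl

lemma IsConstrained.mem_GPrime (h : IsConstrained x) (hdet : x.det ≠ 0) : x ∈ GPrime K := by
  refine ⟨hdet, h.lrRank_two_four hdet, ?_, h.lrRank_two_two hdet, h.lrRank_four_four hdet⟩
  rw [← lrRank_transpose]
  exact h.transpose.lrRank_two_four (by rwa [det_transpose])

end Ranks

/-! ### Choice of the support point and conclusion. -/

section Main

open Matrix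

variable {K : Type*} [RCLike K]

lemma isOpen_setOf_le_rank {m n : Type*} [Fintype m] [Fintype n] {X : Type*} [TopologicalSpace X]
    {A : X → Matrix m n K} (hA : Continuous A) (r : ℕ) : IsOpen {x | r ≤ (A x).rank} := by
  classical
  let T : Matrix m n K →ₗ[K] (n → K) →L[K] (m → K) :=
    LinearMap.toContinuousLinearMap.toLinearMap ∘ₗ Matrix.toLin'.toLinearMap
  have hT : Continuous fun x => T (A x) := (LinearMap.continuous_of_finiteDimensional T).comp hA
  convert (isOpen_setOfPred_nat_le_rank r).preimage hT using 1
  ext x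
  have h : LinearMap.rank (T (A x) : (n → K) →ₗ[K] (m → K)) = (A x).rank := by
    rw [Matrix.rank, ← Matrix.toLin'_apply']
    exact (Module.finrank_eq_rank K _).symm
  simp only [mem_ofPred_eq, mem_preimage, h, Nat.cast_le]

lemma continuous_corner (k l : ℕ) : Continuous (corner k l : Mat K → Mat K) :=
  (contDiff_corner k l).continuous

lemma eventually_le_rank_corner (k l : ℕ) (x₀ : Mat K) :
    ∀ᶠ x in 𝓝 x₀, (corner k l x₀).rank ≤ (corner k l x).rank :=
  (isOpen_setOf_le_rank (continuous_corner k l) _).mem_nhds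
    (mem_ofPred_eq ▸ le_rfl)

lemma lrRank_le_left (i j : ℕ) (x : Mat K) :
    lrRank i j x ≤ Fintype.card {r : Fin 6 // 6 ≤ r.val + i} := rank_le_card_height _

lemma lrRank_le_right (i j : ℕ) (x : Mat K) :
    lrRank i j x ≤ Fintype.card {r : Fin 6 // 6 ≤ r.val + j} := rank_le_card_width _

lemma isOpen_setOf_le_lrRank (i j r : ℕ) : IsOpen {x : Mat K | r ≤ lrRank i j x} :=
  isOpen_setOf_le_rank (continuous_id.matrix_submatrix _ _) r

/-- The two rank equalities ask for the maximal possible rank, so they are lower bounds, which are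
open conditions. -/
lemma isOpen_GPrime : IsOpen (GPrime K) := by
  have h : GPrime K = {x | x.det ≠ 0} ∩ ({x | 2 ≤ lrRank 2 4 x} ∩ ({x | 2 ≤ lrRank 4 2 x} ∩
      ({x | 1 ≤ lrRank 2 2 x} ∩ {x | 3 ≤ lrRank 4 4 x}))) := by
    ext x
    have h1 : lrRank 2 4 x ≤ 2 := lrRank_le_left 2 4 x
    have h2 : lrRank 4 2 x ≤ 2 := lrRank_le_right 4 2 x
    have e1 : lrRank 2 4 x = 2 ↔ 2 ≤ lrRank 2 4 x := by omega
    have e2 : lrRank 4 2 x = 2 ↔ 2 ≤ lrRank 4 2 x := by omega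
    simp only [GPrime, mem_ofPred_eq, mem_inter_iff, e1, e2]
  rw [h]
  exact (GLOpen K).2.inter ((isOpen_setOf_le_lrRank _ _ _).inter ((isOpen_setOf_le_lrRank _ _ _).inter
    ((isOpen_setOf_le_lrRank _ _ _).inter (isOpen_setOf_le_lrRank _ _ _))))

/-- Near a suitable point of the support, the ranks of the lower right corners are locally
maximal. -/
lemma exists_mem_dsupport_rank_le {f : 𝓓'(GLOpen K, ℂ)} (hf : f ≠ 0) :
    ∃ x₀ ∈ dsupport f, x₀.det ≠ 0 ∧ ∀ k ∈ ({1, 2} : Finset ℕ), ∀ l ∈ ({1, 2} : Finset ℕ),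
      ∀ᶠ x in 𝓝 x₀, x ∈ dsupport f → (corner k l x).rank = (corner k l x₀).rank := by
  let R : Mat K → ℕ := fun x => ∑ q ∈ ({1, 2} : Finset ℕ) ×ˢ ({1, 2} : Finset ℕ),
    (corner q.1 q.2 x).rank
  have hne : ∃ x ∈ dsupport f, x.det ≠ 0 := by
    by_contra! h
    refine hf (DFunLike.ext _ _ fun φ => isVanishingOn_compl_dsupport f φ fun x hx hxf => ?_)
    exact φ.tsupport_subset hx (h x hxf)
  have hbdd : BddAbove (R '' {x | x ∈ dsupport f ∧ x.det ≠ 0}) := by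
    refine ⟨∑ q ∈ ({1, 2} : Finset ℕ) ×ˢ ({1, 2} : Finset ℕ), 6, ?_⟩
    rintro _ ⟨x, -, rfl⟩
    exact Finset.sum_le_sum fun q _ => (rank_le_card_height _).trans (by simp)
  obtain ⟨x₀, ⟨hx₀, hdet⟩, hRx₀⟩ := Nat.sSup_mem (Set.Nonempty.image R hne) hbdd
  refine ⟨x₀, hx₀, hdet, fun k hk l hl => ?_⟩
  -- Near `x₀` no single rank can drop, and on the support the total cannot grow, so every rank is
  -- constant there.
  have hall : ∀ᶠ x in 𝓝 x₀, ∀ q ∈ ({1, 2} : Finset ℕ) ×ˢ ({1, 2} : Finset ℕ),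
      (corner q.1 q.2 x₀).rank ≤ (corner q.1 q.2 x).rank :=
    (Finset.eventually_all _).mpr fun q _ => eventually_le_rank_corner q.1 q.2 x₀
  filter_upwards [hall, eventually_det_ne_zero hdet] with x hx hxdet hxf
  have hle : R x ≤ R x₀ := by
    rw [hRx₀]
    exact le_csSup hbdd ⟨x, ⟨hxf, hxdet⟩, rfl⟩
  have heq := (Finset.sum_eq_sum_iff_of_le hx).mp (le_antisymm (Finset.sum_le_sum hx) hle)
  exact (heq (k, l) (Finset.mem_product.mpr ⟨hk, hl⟩)).symm

lemma isKernelMatrix_vecMulVec {k l : ℕ} {x : Mat K} {u w : Fin 6 → K}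
    (hu : ∀ i, i.val < 2 * l → u i = 0) (hw : ∀ i, i.val < 2 * k → w i = 0)
    (hxu : ∀ i, 2 * k ≤ i.val → (x *ᵥ u) i = 0) (hwx : ∀ j, 2 * l ≤ j.val → (w ᵥ* x) j = 0) :
    IsKernelMatrix k l x (vecMulVec u w) := by
  refine ⟨?_, ?_, ?_, ?_⟩
  · ext i j
    rw [lowerProj_mul_apply, ite_eq_left_iff]
    intro hi
    rw [vecMulVec_apply, hu i (by omega), zero_mul]
  · ext i j
    rw [mul_lowerProj_apply, ite_eq_left_iff]
    intro hj
    rw [vecMulVec_apply, hw j (by omega), mul_zero]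
  · ext i j
    rw [mul_assoc, lowerProj_mul_apply, mul_vecMulVec, vecMulVec_apply, Matrix.zero_apply,
      ite_eq_right_iff]
    intro hi
    rw [hxu i hi, zero_mul]
  · ext i j
    rw [mul_lowerProj_apply, vecMulVec_mul, vecMulVec_apply, Matrix.zero_apply, ite_eq_right_iff]
    intro hj
    rw [hwx j hj, mul_zero]

lemma shift_mulVec (y : Fin 6 → K) : shift K *ᵥ y = ![0, 0, y 0, y 1, y 2, y 3] := by
  ext i
  fin_cases i <;> simp [shift, mulVec, dotProduct, Fin.sum_univ_six]

lemma shift_transpose_mulVec (y : Fin 6 → K) :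
    (shift K)ᵀ *ᵥ y = ![y 2, y 3, y 4, y 5, 0, 0] := by
  ext i
  fin_cases i <;> simp [shift, mulVec, dotProduct, Fin.sum_univ_six]

lemma trace_vecMulVec_mul (u w : Fin 6 → K) (A : Mat K) :
    (vecMulVec u w * A).trace = w ⬝ᵥ (A *ᵥ u) := by
  rw [vecMulVec_mul, trace_vecMulVec, dotProduct_comm, ← dotProduct_mulVec]

lemma trace_vecMulVec_mul_sq (u w : Fin 6 → K) (A : Mat K) :
    (vecMulVec u w * A * (vecMulVec u w * A)).trace = (w ⬝ᵥ (A *ᵥ u)) ^ 2 := by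
  rw [vecMulVec_mul, vecMulVec_mul_vecMulVec, trace_vecMulVec, dotProduct_smul, dotProduct_comm u,
    ← dotProduct_mulVec, smul_eq_mul, sq]

theorem eq_zero_of_isVanishingOn {χ : Kˣ →* ℂˣ} {ψ : AddChar K Circle} (hψ : ψ ≠ 1)
    (f : 𝓓'(GLOpen K, ℂ)) (hf : IsEquivariant χ ψ f)
    (hΔ : ∃ μ : ℂ, casimir (f : 𝓓(GLOpen K, ℝ) →ₗ[ℝ] ℂ) = μ • (f : 𝓓(GLOpen K, ℝ) →ₗ[ℝ] ℂ))
    (hG : IsVanishingOn f (GPrime K)) : f = 0 := by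
  by_contra hf0
  obtain ⟨μ, hΔ⟩ := hΔ
  obtain ⟨κ, hκ, hL, hR⟩ := exists_infinitesimal_character hψ hf hf0
  obtain ⟨x₀, hx₀, hdet, hrank⟩ := exists_mem_dsupport_rank_le hf0
  have hx₀G : x₀ ∈ GPrime K := by
    refine IsConstrained.mem_GPrime (fun k hk l hl u w hu hw hxu hwx => ?_) hdet
    have hkl := hrank k (by simpa using hk) l (by simpa using hl)
    -- The second constraint needs the first at all nearby support points. It is available because
    -- the corner rank is locally constant on the support around each of them.
    have htr : ∀ᶠ x in 𝓝 x₀, x ∈ dsupport f → ∀ Θ, IsKernelMatrix k l x Θ →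
        (Θ * (shift K * x - x * (shift K).transpose)).trace = 0 := by
      filter_upwards [hkl.eventually_nhds, eventually_det_ne_zero hdet] with x hx hxdet hxf Θ hΘ
      refine trace_kernelMatrix_eq_zero hκ (hL k) (hR l) hxf hxdet ?_ hΘ
      filter_upwards [hx] with y hy hyf
      rw [hy hyf, hx.self_of_nhds hxf]
    have hker := isKernelMatrix_vecMulVec hu hw hxu hwx
    have h1 := htr.self_of_nhds hx₀ _ hker
    have h2 := trace_sq_kernelMatrix_eq_zero hΔ hx₀ hdet
      (hkl.mono fun x hx hxf => (hx hxf).le) htr hker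
    rw [mul_sub, trace_sub, trace_vecMulVec_mul, trace_vecMulVec_mul, sub_eq_zero] at h1
    -- With `wᵀ J x u = wᵀ x Jᵀ u` the sum of squares is twice one square, so both numbers vanish,
    -- also over `ℂ`.
    rw [trace_vecMulVec_mul_sq, trace_vecMulVec_mul_sq, h1, ← two_mul, mul_eq_zero,
      pow_eq_zero_iff two_ne_zero, or_iff_right two_ne_zero] at h2
    rw [h2] at h1
    rw [← mulVec_mulVec, shift_mulVec] at h1
    rw [← mulVec_mulVec, dotProduct_mulVec, shift_transpose_mulVec] at h2
    constructor
    · rw [← h1]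
      simp [dotProduct, Fin.sum_univ_six]
    · rw [← h2]
      simp [dotProduct, Fin.sum_univ_six]
  exact not_isVanishingOn_of_mem_nhds hx₀ (isOpen_GPrime.mem_nhds hx₀G) hG

end Main

end GinzburgRallis

end

theorem mainTheorem7 {K : Type*} [RCLike K]
    (χ : Kˣ →* ℂˣ) (hχ : Continuous χ)
    (ψ : AddChar K Circle) (hψ : Continuous ψ) (hψ_ne : ψ ≠ 1)
    (f : 𝓓'(GinzburgRallis.GLOpen K, ℂ))
    (hf : GinzburgRallis.IsEquivariant χ ψ f)
    (hΔ : ∃ μ : ℂ, GinzburgRallis.casimir (f : 𝓓(GinzburgRallis.GLOpen K, ℝ) →ₗ[ℝ] ℂ) =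
      μ • (f : 𝓓(GinzburgRallis.GLOpen K, ℝ) →ₗ[ℝ] ℂ))
    (hG : Distribution.IsVanishingOn f (GinzburgRallis.GPrime K)) :
    f = 0 := by
  exact GinzburgRallis.eq_zero_of_isVanishingOn hψ_ne f hf hΔ hG
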